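/- Let $\mathbb H\neq\{0\}$ be a separable complex Hilbert space with a fixed complete orthonormal system $\{e_j\}$; an element of $\mathbb H$ is called real if all its coordinates $\langle x,e_j\rangle$ are real. Let $d\ge 1$, $\beta,L>0$, and let $\|\cdot\|_{\rm tr}$, $\|\cdot\|_{\rm HS}$ be the trace and Hilbert--Schmidt norms. For a zero-mean, second-order stationary process $X=\{X(t),t\in\mathbb R^d\}$ with values in the real elements of $\mathbb H$, write $C(h)=\mathbb E[X(t+h)\otimes X(t)]$, where $(x\otimes y)z=\langle z,y\rangle x$. If $C$ is continuous at $0$ in trace norm and $\int_{\mathbb R^d}\|C(x)\|_{\rm tr}\,dx<\infty$, the spectral density of $X$ is $$f(\theta)=(2\pi)^{-d}\int_{\mathbb R^d}e^{\mathbf i x^\top\theta}C(x)\,dx,\qquad \theta\in\mathbb R^d.$$ Let $\mathcal P_C(\beta,L)$ be the class of all spectral densities $f$ of such processes for which $$\int_{\mathbb R^d}(1+\|x\|_2^\beta)\,\|C(x)\|_{\rm tr}\,dx\le L .$$ Let $\delta_n>0$ be a sequence with $n\delta_n\to\infty$, and let $\mathcal M_n$ be the class of all estimators $f_n$ of $f$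 based on the observations $X(k\delta_n)$, $k\in\{1,\dots,n\}^d$. Then, for each $\theta_0\in\mathbb R^d$, $$\liminf_{n\to\infty}\ \inf_{f_n\in\mathcal M_n}\ \sup_{f\in\mathcal P_C(\beta,L)}\ \mathbb P_f\Big(\|f_n(\theta_0)-f(\theta_0)\|_{\rm HS}\ge (n\delta_n)^{-\frac{d\beta}{2\beta+d}}\Big)>0,$$ where under $\mathbb P_f$ the process $X$ is a zero-mean real stationary Gaussian process indexed by $\mathbb R^d$ with spectral density $f$. -/

import Mathlib

open MeasureTheory ProbabilityTheory Filter Topology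
open scoped ENNReal InnerProductSpace

namespace SpectralMinimax

noncomputable section

/-- The Euclidean space `ℝ^d`. -/
abbrev Space (d : ℕ) : Type := EuclideanSpace ℝ (Fin d)

section Operators

variable {ι H : Type*} [NormedAddCommGroup H] [InnerProductSpace ℂ H]

/-- The rank-one operator `x ⊗ y : z ↦ ⟨z, y⟩ x`, where `⟨z, y⟩` is linear in `z`
(Mathlib's `inner ℂ y z`). -/
def outer (x y : H) : H →L[ℂ] H := InnerProductSpace.rankOne ℂ x y

/-- `x` is a real element of `H` with respect to the real complete orthonormal system `e`:
all its coordinates are real, that is, `x` equals its conjugate `∑ conj ⟨x, e j⟩ e j`. -/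
def IsRealElement (e : HilbertBasis ι ℂ H) (x : H) : Prop :=
  ∀ j, (e.repr x j).im = 0

variable [CompleteSpace H]

/-- The trace norm `∑ j, ⟨(A* A)^{1/2} e j, e j⟩` in `[0, ∞]`; `A` is trace class iff it is finite.
Its value does not depend on the complete orthonormal system `e`. -/
def traceNorm (e : HilbertBasis ι ℂ H) (A : H →L[ℂ] H) : ℝ≥0∞ :=
  ∑' j, ENNReal.ofReal (inner ℂ (e j) (CFC.sqrt (star A * A) (e j))).re

/-- The Hilbert-Schmidt norm `‖A* A‖_tr ^ (1/2)` in `[0, ∞]`; `A` is Hilbert-Schmidt iff it is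
finite. -/
def hsNorm (e : HilbertBasis ι ℂ H) (A : H →L[ℂ] H) : ℝ≥0∞ :=
  traceNorm e (star A * A) ^ (1 / 2 : ℝ)

end Operators

section Processes

variable {ι H Ω : Type*} [NormedAddCommGroup H] [InnerProductSpace ℂ H]
  [MeasurableSpace Ω] {d : ℕ}

/-- `X` is a zero-mean, second-order, real (with respect to `e`), second-order stationary process
indexed by `ℝ^d` with stationary covariance operator `C h = E[X (t + h) ⊗ X t]`. (For a real process
the pseudo-covariance operator is the covariance operator.) -/
structure IsStationaryProcess (e : HilbertBasis ι ℂ H) (X : Space d → Ω → H) (P : Measure Ω)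
    (C : Space d → H →L[ℂ] H) : Prop where
  isProbabilityMeasure : IsProbabilityMeasure P
  memLp : ∀ t, MemLp (X t) 2 P
  mean_eq_zero : ∀ t, ∫ ω, X t ω ∂P = 0
  real : ∀ t, ∀ᵐ ω ∂P, IsRealElement e (X t ω)
  covariance : ∀ t h, ∫ ω, outer (X (t + h) ω) (X t ω) ∂P = C h

/-- `f θ = (2π)^{-d} ∫ exp(i xᵀ θ) C x dx`. -/
def spectralTransform (C : Space d → H →L[ℂ] H) (θ : Space d) : H →L[ℂ] H :=
  ((((2 * Real.pi) ^ d)⁻¹ : ℝ) : ℂ) •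
    ∫ x : Space d, Complex.exp (Complex.I * ((inner ℝ x θ : ℝ) : ℂ)) • C x

variable [CompleteSpace H]

/-- The stationary process `X` has the spectral density `f`: its stationary covariance operator `C`
is continuous at `0` in trace norm and has an integrable trace norm, and `f` is the transform
of `C`. -/
def HasSpectralDensity (e : HilbertBasis ι ℂ H) (X : Space d → Ω → H) (P : Measure Ω)
    (f : Space d → H →L[ℂ] H) : Prop :=
  ∃ C : Space d → H →L[ℂ] H,
    IsStationaryProcess e X P C ∧
    Tendsto (fun h => traceNorm e (C h - C 0)) (𝓝 0) (𝓝 0) ∧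
    ∫⁻ x, traceNorm e (C x) < ∞ ∧
    f = spectralTransform C

variable [MeasurableSpace H]

/-- The continuous-time power-law class `P_C(β, L)`: all spectral densities
`f θ = (2π)^{-d} ∫ exp(i xᵀ θ) C x dx` with `∫ (1 + ‖x‖^β) ‖C x‖_tr dx ≤ L`, where `C` is the
trace-norm continuous covariance operator of a real second-order stationary process indexed by
`ℝ^d`. The process is given by its law on path space. -/
def powerLawClass (e : HilbertBasis ι ℂ H) (d : ℕ) (β L : ℝ) : Set (Space d → H →L[ℂ] H) :=
  {f | ∃ C : Space d → H →L[ℂ] H,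
    (∃ P : Measure (Space d → H), IsStationaryProcess e (fun t ω => ω t) P C) ∧
    Tendsto (fun h => traceNorm e (C h - C 0)) (𝓝 0) (𝓝 0) ∧
    ∫⁻ x, ENNReal.ofReal (1 + ‖x‖ ^ β) * traceNorm e (C x) ≤ ENNReal.ofReal L ∧
    f = spectralTransform C}

/-- `P` is the law, on path space, of a real stationary Gaussian process indexed by `ℝ^d` with
spectral density `f`. -/
def IsStationaryGaussianLaw (e : HilbertBasis ι ℂ H) (P : Measure (Space d → H))
    (f : Space d → H →L[ℂ] H) : Prop :=
  IsGaussianProcess (fun (t : Space d) (ω : Space d → H) => ω t) P ∧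
    HasSpectralDensity e (fun t ω => ω t) P f

end Processes

section Estimation

variable {ι H : Type*} [NormedAddCommGroup H] [InnerProductSpace ℂ H] {d : ℕ}

/-- The sampling location `δ k`, for `k ∈ {1, …, n}^d` (the index `k : Fin d → Fin n` is shifted
by one in each coordinate). -/
def gridPoint {n : ℕ} (δ : ℝ) (k : Fin d → Fin n) : Space d :=
  WithLp.toLp 2 fun l => δ * ((k l : ℕ) + 1 : ℝ)

/-- The observations `X (δ k)`, `k ∈ {1, …, n}^d`, extracted from a path `ω`. -/
def observations (n : ℕ) (δ : ℝ) (ω : Space d → H) : (Fin d → Fin n) → H :=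
  fun k => ω (gridPoint δ k)

/-- The class `M_n` of all estimators of the operator-valued function `f` based on `n^d` observations:
all maps from the data to functions `ℝ^d → H →L[ℂ] H` for which each matrix element of the estimate
of `f θ` is a measurable function of the data. -/
def estimators (H : Type*) [NormedAddCommGroup H] [InnerProductSpace ℂ H] [MeasurableSpace H]
    (d n : ℕ) : Set (((Fin d → Fin n) → H) → Space d → H →L[ℂ] H) :=
  {T | ∀ θ u v, Measurable fun x => inner ℂ u (T x θ v)}

end Estimation

end

end SpectralMinimax

/-! The proof is Le Cam's two-point method. Multiplying a real stationary Gaussian process by a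
fixed basis vector `e j` gives an admissible operator-valued model, and the Hilbert–Schmidt norm
dominates the `(j, j)` matrix element, so it suffices to separate two scalar covariances
(`two_point_lower_bound`).

The reference covariance is `c * expKernel`, a product of Ornstein–Uhlenbeck covariances, plus the
covariance whose spectral density is a Gaussian bump of width `1` at `θ₀`. The alternative adds a
bump of width `h ≤ 1` with amplitude `a * h ^ β`. Rescaling space by `h` shows that this amplitude
keeps the weighted integral of the covariance bounded uniformly in `h` (`isAdmissible_bump`), while
the densities at `θ₀` differ by at least `a * h ^ β / 2`.

Let `S` be the covariance matrix of the data under the reference and `D` that of the perturbation.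
After simultaneous diagonalization the test is between products of `N(0, 1)` and `N(0, 1 + v i)`,
where `v i` are the eigenvalues of `D` relative to `S`, and the Hellinger affinity is bounded below
in terms of `∑ v i ^ 2 ≤ max v * ∑ v`. The maximum is at most `h ^ β`, because the narrow bump lies
below the wide one. The sum is the trace of `S⁻¹ * D`, an average of quadratic forms of `S⁻¹` at
complex exponentials. Since `S` dominates `c` times the Ornstein–Uhlenbeck matrix, whose Cholesky
factor is that of a first-order autoregression, these forms can be computed by whitening; each is
`O((n * δ) ^ d)` at fixed frequency, however fine or coarse the grid (`cos_sin_sq_le_expKernel`,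
`trace_inv_mul_gridMatrix_le`).

Altogether `∑ v i ^ 2 = O(h ^ (2 * β + d) * (n * δ) ^ d)`. With `h` proportional to `(n * δ) ^ (-d /
(2 * β + d))` it stays bounded, and the separation `h ^ β` is the claimed rate. -/

open scoped NNReal

/-! ### Existence of Gaussian processes with a prescribed covariance kernel -/

namespace SpectralMinimax

/-- A real positive semidefinite kernel has a feature map into a real Hilbert space. -/
theorem exists_featureMap {T : Type} (K : T → T → ℝ) (symm : ∀ s t, K s t = K t s)
    (nonneg : ∀ (I : Finset T) (a : T → ℝ), 0 ≤ ∑ s ∈ I, ∑ t ∈ I, a s * a t * K s t) :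
    ∃ (E : Type) (_ : NormedAddCommGroup E) (_ : InnerProductSpace ℝ E) (_ : CompleteSpace E)
      (φ : T → E), ∀ s t, inner ℝ (φ s) (φ t) = K s t := by
  -- Reproducing kernels are operator-valued here, so the scalar `K s t` is read as a multiplication
  -- operator on `ℝ`, and the features are the kernel sections applied to `1`.
  let M : Matrix T T (ℝ →L[ℝ] ℝ) := .of fun s t => K s t • ContinuousLinearMap.id ℝ ℝ
  have hM : M.PosSemidef := by
    have h := (RKHS.posSemidef_tfae (K := M)).out 0 2
    refine h.mpr ⟨?_, fun v => ?_⟩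
    · refine Matrix.IsHermitian.ext fun i j => ?_
      simp only [M, Matrix.of_apply, star_smul, star_trivial, symm i j]
      rw [ContinuousLinearMap.star_eq_adjoint]
      congr 1
      exact ContinuousLinearMap.adjoint_id
    · simp only [M, Finsupp.sum, Matrix.of_apply]
      refine (nonneg v.support v).trans_eq ?_
      rw [Finset.sum_comm]
      simp only [RCLike.re_to_real]
      refine Finset.sum_congr rfl fun s _ => Finset.sum_congr rfl fun t _ => ?_
      simp
      ring
  have : Fact M.PosSemidef := ⟨hM⟩
  refine ⟨RKHS.OfKernel M, inferInstance, inferInstance, inferInstance,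
    fun t => RKHS.kerFun (RKHS.OfKernel M) t (1 : ℝ), fun s t => ?_⟩
  rw [← RKHS.kernel_inner, RKHS.OfKernel.kernel_ofKernel]
  simp [M, symm]

section Isonormal

variable {κ : Type}

/-- The coordinates of an infinite product of standard Gaussian laws. -/
theorem memLp_coord (i : κ) :
    MemLp (fun ω : κ → ℝ => ω i) 2 (Measure.infinitePi fun _ : κ => gaussianReal 0 1) := by
  have h := (IsGaussian.memLp_two_id (μ := gaussianReal 0 1))
  exact h.comp_measurePreserving (measurePreserving_eval_infinitePi (fun _ : κ => gaussianReal 0 1) i)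

theorem integral_cexp_sum_coord (s : Finset κ) (c : κ → ℝ) :
    ∫ ω : κ → ℝ, Complex.exp (Complex.I * ((∑ i ∈ s, c i * ω i : ℝ) : ℂ))
      ∂(Measure.infinitePi fun _ : κ => gaussianReal 0 1)
      = Complex.exp (-(1 / 2) * ((∑ i ∈ s, c i ^ 2 : ℝ) : ℂ)) := by
  have h1 := integral_restrict_infinitePi (μ := fun _ : κ => gaussianReal 0 1) (s := s)
    (f := fun y : s → ℝ => ∏ i : s, Complex.exp (Complex.I * ((c i * y i : ℝ) : ℂ)))
    (by
      refine Measurable.aestronglyMeasurable ?_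
      fun_prop)
  have h2 : ∀ ω : κ → ℝ, Complex.exp (Complex.I * ((∑ i ∈ s, c i * ω i : ℝ) : ℂ))
      = ∏ i : s, Complex.exp (Complex.I * ((c i * s.restrict ω i : ℝ) : ℂ)) := by
    intro ω
    rw [← Complex.exp_sum, ← Finset.mul_sum]
    congr 2
    rw [← Finset.sum_coe_sort]
    push_cast
    rfl
  simp_rw [h2]
  rw [h1, integral_fintype_prod_eq_prod
    (f := fun (i : s) (y : ℝ) => Complex.exp (Complex.I * ((c i * y : ℝ) : ℂ)))]
  have h3 : ∀ i : s, ∫ y, Complex.exp (Complex.I * ((c i * y : ℝ) : ℂ)) ∂(gaussianReal 0 1)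
      = Complex.exp (-(1 / 2) * ((c i ^ 2 : ℝ) : ℂ)) := by
    intro i
    have := charFun_gaussianReal (μ := 0) (v := 1) (c i)
    rw [charFun_apply_real] at this
    convert this using 2
    · ext y; congr 1; push_cast; ring
    · push_cast; simp; ring
  simp_rw [h3]
  rw [← Complex.exp_sum, ← Finset.mul_sum]
  congr 2
  push_cast
  exact Finset.sum_coe_sort s fun i => (c i : ℂ) ^ 2

theorem norm_cexp_I_mul_sub_le (x y : ℝ) :
    ‖Complex.exp (Complex.I * (x : ℂ)) - Complex.exp (Complex.I * (y : ℂ))‖ ≤ |x - y| := by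
  have h : Complex.exp (Complex.I * (x : ℂ)) - Complex.exp (Complex.I * (y : ℂ))
      = Complex.exp (Complex.I * (y : ℂ)) * (Complex.exp (Complex.I * ((x - y : ℝ) : ℂ)) - 1) := by
    rw [mul_sub, ← Complex.exp_add]
    push_cast
    ring_nf
  rw [h, norm_mul, mul_comm Complex.I (y : ℂ), Complex.norm_exp_ofReal_mul_I, one_mul]
  simpa using Real.norm_exp_I_mul_ofReal_sub_one_le (x := x - y)

/-- The isonormal process: an isometry from `E` to `L²` with Gaussian values. -/
theorem exists_isonormal (E : Type) [NormedAddCommGroup E] [InnerProductSpace ℝ E]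
    [CompleteSpace E] :
    ∃ (Ω : Type) (_ : MeasurableSpace Ω) (P : Measure Ω) (_ : IsProbabilityMeasure P)
      (V : E →ₗᵢ[ℝ] Lp ℝ 2 P),
      ∀ x, ∫ ω, Complex.exp (Complex.I * ((V x ω : ℝ) : ℂ)) ∂P
        = Complex.exp (-(1 / 2) * ((‖x‖ ^ 2 : ℝ) : ℂ)) := by
  obtain ⟨w, b, -⟩ := exists_hilbertBasis ℝ E
  let P : Measure (w → ℝ) := Measure.infinitePi fun _ : w => gaussianReal 0 1
  let ξ : w → Lp ℝ 2 P := fun i => (memLp_coord i).toLp _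
  have hξ : Orthonormal ℝ ξ := by
    classical
    rw [orthonormal_iff_ite]
    intro i j
    rw [L2.inner_def]
    have h1 : ∫ ω, inner ℝ (ξ i ω) (ξ j ω) ∂P = ∫ ω, ω j * ω i ∂P := by
      refine integral_congr_ae ?_
      filter_upwards [(memLp_coord i).coeFn_toLp, (memLp_coord j).coeFn_toLp] with ω h h'
      simp only [ξ]
      rw [h, h']
      simp
    rw [h1]
    split_ifs with h
    · subst h
      have h2 := (measurePreserving_eval_infinitePi (fun _ : w => gaussianReal 0 1) i)
      have h3 := integral_map (μ := P) h2.measurable.aemeasurable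
        (f := fun x : ℝ => x * x) (by fun_prop)
      rw [h2.map_eq] at h3
      have h4 : ∫ ω, ω i * ω i ∂P = ∫ ω : w → ℝ, (fun x : ℝ => x * x) (Function.eval i ω) ∂P := rfl
      rw [h4, ← h3]
      have h5 := variance_id_gaussianReal (μ := 0) (v := 1)
      rw [variance_of_integral_eq_zero (by fun_prop) (by simp)] at h5
      simpa [sq] using h5
    · have hind : IndepFun (fun ω : w → ℝ => ω j) (fun ω : w → ℝ => ω i) P := by
        have := iIndepFun_infinitePi (P := fun _ : w => gaussianReal 0 1) (X := fun _ x => x)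
          (fun _ => measurable_id)
        exact this.indepFun (Ne.symm h)
      have h2 := hind.integral_fun_mul_eq_mul_integral
        (measurable_pi_apply j).aestronglyMeasurable (measurable_pi_apply i).aestronglyMeasurable
      rw [h2]
      have h3 : ∫ ω : w → ℝ, ω i ∂P = 0 := by
        have h2 := (measurePreserving_eval_infinitePi (fun _ : w => gaussianReal 0 1) i)
        have h3 := integral_map (μ := P) h2.measurable.aemeasurable
          (f := fun x : ℝ => x) (by fun_prop)
        rw [h2.map_eq] at h3
        simp only [integral_id_gaussianReal] at h3
        exact h3.symm
      rw [h3, mul_zero]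
  -- The basis of `E`, of any cardinality, is sent to independent standard Gaussian coordinates.
  let V : E →ₗᵢ[ℝ] Lp ℝ 2 P :=
    hξ.orthogonalFamily.linearIsometry.comp b.repr.toLinearIsometry
  have hVb : ∀ i, V (b i) = ξ i := by
    classical
    intro i
    change hξ.orthogonalFamily.linearIsometry (b.repr (b i)) = ξ i
    rw [HilbertBasis.repr_self, OrthogonalFamily.linearIsometry_apply_single]
    simp
  refine ⟨w → ℝ, inferInstance, P, inferInstance, V, fun x => ?_⟩
  -- The characteristic function is explicit on finite combinations of the basis. Both sides are
  -- continuous in `x`, so the identity passes to the closure of the span.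
  have hcont : Continuous fun x => ∫ ω, Complex.exp (Complex.I * ((V x ω : ℝ) : ℂ)) ∂P := by
    have hint : ∀ x, Integrable (fun ω => Complex.exp (Complex.I * ((V x ω : ℝ) : ℂ))) P := by
      intro x
      have hm : AEStronglyMeasurable (fun ω => V x ω) P := (Lp.memLp (V x)).1
      refine Integrable.of_bound (C := 1) ?_ (Eventually.of_forall fun ω => ?_)
      · have : Continuous fun y : ℝ => Complex.exp (Complex.I * (y : ℂ)) := by fun_prop
        exact this.comp_aestronglyMeasurable hm
      · rw [mul_comm, Complex.norm_exp_ofReal_mul_I]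
    refine LipschitzWith.continuous (K := 1) (LipschitzWith.of_dist_le_mul fun x y => ?_)
    rw [dist_eq_norm, ← integral_sub (hint x) (hint y)]
    have hm : MemLp (fun ω => V (x - y) ω) 2 P := Lp.memLp (V (x - y))
    have hsub : (fun ω => V (x - y) ω) =ᵐ[P] fun ω => V x ω - V y ω := by
      rw [map_sub]; exact Lp.coeFn_sub _ _
    calc ‖∫ ω, (Complex.exp (Complex.I * ((V x ω : ℝ) : ℂ)) -
            Complex.exp (Complex.I * ((V y ω : ℝ) : ℂ))) ∂P‖
        ≤ ∫ ω, ‖V (x - y) ω‖ ∂P := by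
          refine norm_integral_le_of_norm_le (hm.integrable one_le_two).norm ?_
          filter_upwards [hsub] with ω h
          rw [h]
          exact norm_cexp_I_mul_sub_le _ _
      _ ≤ ‖V (x - y)‖ := by
          rw [Lp.norm_def, integral_norm_eq_lintegral_enorm hm.1]
          refine ENNReal.toReal_mono (Lp.eLpNorm_ne_top _) ?_
          rw [← eLpNorm_one_eq_lintegral_enorm]
          exact eLpNorm_le_eLpNorm_of_exponent_le one_le_two hm.1
      _ = ((1 : NNReal) : ℝ) * dist x y := by
          rw [LinearIsometry.norm_map, dist_eq_norm]; simp
  have hcont' : Continuous fun x : E => Complex.exp (-(1 / 2) * ((‖x‖ ^ 2 : ℝ) : ℂ)) := by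
    fun_prop
  have hclosed := isClosed_eq hcont hcont'
  have hdense : Dense (Submodule.span ℝ (Set.range b) : Set E) := by
    rw [Submodule.dense_iff_topologicalClosure_eq_top]
    exact b.dense_span
  refine hclosed.closure_subset_iff.mpr (fun y hy => ?_) (hdense x)
  obtain ⟨c, rfl⟩ := (Finsupp.mem_span_range_iff_exists_finsupp).mp hy
  simp only [Set.mem_ofPred_eq, Finsupp.sum]
  have hn : ‖∑ i ∈ c.support, c i • b i‖ ^ 2 = ∑ i ∈ c.support, c i ^ 2 := by
    rw [← real_inner_self_eq_norm_sq, b.orthonormal.inner_sum]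
    simp [sq]
  rw [hn, ← integral_cexp_sum_coord]
  refine integral_congr_ae ?_
  have h1 : V (∑ i ∈ c.support, c i • b i) = ∑ i ∈ c.support, c i • ξ i := by
    simp [map_sum, hVb]
  rw [h1]
  have h2 : ⇑(∑ i ∈ c.support, c i • ξ i) =ᵐ[P] fun ω => ∑ i ∈ c.support, c i * ω i := by
    have h3 := Lp.coeFn_finsetSum (E := ℝ) (p := 2) (μ := P) c.support (fun i => c i • ξ i)
    have h4 : ∀ᵐ ω ∂P, ∀ i ∈ c.support, (c i • ξ i : Lp ℝ 2 P) ω = c i * ω i := by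
      rw [Filter.eventually_all_finset]
      intro i _
      filter_upwards [Lp.coeFn_smul (c i) (ξ i), (memLp_coord i).coeFn_toLp] with ω h h'
      rw [h, Pi.smul_apply, smul_eq_mul]
      simp only [ξ]
      rw [h']
    filter_upwards [h3, h4] with ω h h'
    rw [h]
    simp only [Finset.sum_apply]
    exact Finset.sum_congr rfl h'
  filter_upwards [h2] with ω h
  rw [h]

end Isonormal

/-- Existence of a centered Gaussian process with a given covariance kernel, as a law on path
space. -/
theorem exists_gaussian_path_measure {T : Type} (K : T → T → ℝ) (symm : ∀ s t, K s t = K t s)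
    (nonneg : ∀ (I : Finset T) (a : T → ℝ), 0 ≤ ∑ s ∈ I, ∑ t ∈ I, a s * a t * K s t) :
    ∃ P : Measure (T → ℝ), IsProbabilityMeasure P ∧
      ∀ (κ : Type) (_ : Fintype κ) (t : κ → T) (a : κ → ℝ),
        ∫ ω, Complex.exp (Complex.I * ((∑ k, a k * ω (t k) : ℝ) : ℂ)) ∂P
          = Complex.exp (-(1 / 2) * ((∑ k, ∑ l, a k * a l * K (t k) (t l) : ℝ) : ℂ)) := by
  obtain ⟨E, _, _, _, φ, hφ⟩ := exists_featureMap K symm nonneg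
  obtain ⟨Ω, _, P, _, V, hV⟩ := exists_isonormal E
  have hm : ∀ x, AEMeasurable (fun ω => V x ω) P := fun x => (Lp.memLp (V x)).1.aemeasurable
  -- Elements of `Lp` are classes; choosing a measurable representative at each `t` makes the path
  -- map measurable into the product space.
  let Y : Ω → T → ℝ := fun ω t => (hm (φ t)).mk _ ω
  have hY : Measurable Y := measurable_pi_lambda _ fun t => (hm (φ t)).measurable_mk
  refine ⟨P.map Y, Measure.isProbabilityMeasure_map hY.aemeasurable, fun κ _ t a => ?_⟩
  rw [integral_map hY.aemeasurable (Measurable.aestronglyMeasurable (by fun_prop))]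
  have h1 := hV (∑ k, a k • φ (t k))
  have h2 : ‖∑ k, a k • φ (t k)‖ ^ 2 = ∑ k, ∑ l, a k * a l * K (t k) (t l) := by
    rw [← real_inner_self_eq_norm_sq, sum_inner]
    simp_rw [inner_sum, real_inner_smul_left, real_inner_smul_right, hφ, mul_assoc]
  rw [h2] at h1
  rw [← h1]
  refine integral_congr_ae ?_
  have h3 := Lp.coeFn_finsetSum (E := ℝ) (p := 2) (μ := P) Finset.univ (fun k => a k • V (φ (t k)))
  have h4 : ∀ᵐ ω ∂P, ∀ k, (a k • V (φ (t k)) : Lp ℝ 2 P) ω = a k * Y ω (t k) := by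
    rw [ae_all_iff]
    intro k
    filter_upwards [Lp.coeFn_smul (a k) (V (φ (t k))), (hm (φ (t k))).ae_eq_mk] with ω h h'
    rw [h, Pi.smul_apply, smul_eq_mul, h']
  have h5 : V (∑ k, a k • φ (t k)) = ∑ k, a k • V (φ (t k)) := by simp [map_sum]
  rw [h5]
  filter_upwards [h3, h4] with ω h h'
  rw [h]
  simp only [Finset.sum_apply]
  simp_rw [h']

end SpectralMinimax

namespace SpectralMinimax

/-! ### Hellinger affinity and tests between products of Gaussian laws -/

section Testing

/-- Le Cam's inequality: the sum of the error probabilities of a test is bounded below by half of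
the squared Hellinger affinity. -/
theorem affinity_sq_le {α : Type*} [MeasurableSpace α] (μ : Measure α) [IsProbabilityMeasure μ]
    (r : α → ℝ≥0∞) (hr : Measurable r) [IsProbabilityMeasure (μ.withDensity r)]
    {B : Set α} (hB : MeasurableSet B) :
    (∫⁻ x, r x ^ (1 / 2 : ℝ) ∂μ) ^ (2 : ℝ) ≤ 2 * (μ B + μ.withDensity r Bᶜ) := by
  -- Cauchy–Schwarz on `C`. It is applied to `B` and `Bᶜ`, each time bounding by `1` the factor that
  -- is not an error probability.
  have key : ∀ C : Set α, MeasurableSet C →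
      ∫⁻ x in C, r x ^ (1 / 2 : ℝ) ∂μ ≤ (μ.withDensity r C) ^ (1 / 2 : ℝ) * μ C ^ (1 / 2 : ℝ) := by
    intro C hC
    have h := ENNReal.lintegral_mul_norm_pow_le (μ := μ.restrict C) (f := r) (g := fun _ => 1)
      (p := 1 / 2) (q := 1 / 2) hr.aemeasurable aemeasurable_const (by norm_num) (by norm_num)
      (by norm_num)
    simpa [withDensity_apply r hC] using h
  have hsum : ∫⁻ x, r x ^ (1 / 2 : ℝ) ∂μ
      ≤ μ B ^ (1 / 2 : ℝ) + (μ.withDensity r Bᶜ) ^ (1 / 2 : ℝ) := by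
    rw [← lintegral_add_compl _ hB]
    refine add_le_add ((key B hB).trans ?_) ((key _ hB.compl).trans ?_)
    · exact mul_le_of_le_one_left' (ENNReal.rpow_le_one prob_le_one (by norm_num))
    · exact mul_le_of_le_one_right' (ENNReal.rpow_le_one prob_le_one (by norm_num))
  calc (∫⁻ x, r x ^ (1 / 2 : ℝ) ∂μ) ^ (2 : ℝ)
      ≤ (μ B ^ (1 / 2 : ℝ) + (μ.withDensity r Bᶜ) ^ (1 / 2 : ℝ)) ^ (2 : ℝ) :=
        ENNReal.rpow_le_rpow hsum (by norm_num)
    _ ≤ 2 ^ ((2 : ℝ) - 1) * ((μ B ^ (1 / 2 : ℝ)) ^ (2 : ℝ)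
          + ((μ.withDensity r Bᶜ) ^ (1 / 2 : ℝ)) ^ (2 : ℝ)) :=
        ENNReal.rpow_add_le_mul_rpow_add_rpow _ _ (by norm_num)
    _ = 2 * (μ B + μ.withDensity r Bᶜ) := by
        rw [← ENNReal.rpow_mul, ← ENNReal.rpow_mul]
        norm_num

/-- The density of `N(0, 1 + v)` with respect to `N(0, 1)`. -/
noncomputable def gaussianRatio (v : ℝ≥0) (x : ℝ) : ℝ :=
  (√(1 + v))⁻¹ * Real.exp (x ^ 2 * v / (2 * (1 + v)))

theorem gaussianRatio_nonneg (v : ℝ≥0) (x : ℝ) : 0 ≤ gaussianRatio v x := by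
  unfold gaussianRatio; positivity

theorem measurable_gaussianRatio (v : ℝ≥0) :
    Measurable fun x => ENNReal.ofReal (gaussianRatio v x) := by
  unfold gaussianRatio; fun_prop

theorem gaussianReal_one_add_eq_withDensity (v : ℝ≥0) :
    gaussianReal 0 (1 + v)
      = (gaussianReal 0 1).withDensity fun x => ENNReal.ofReal (gaussianRatio v x) := by
  rw [gaussianReal_of_var_ne_zero 0 (by positivity : (1 + v) ≠ 0),
    gaussianReal_of_var_ne_zero 0 one_ne_zero,
    ← withDensity_mul _ (measurable_gaussianPDF 0 1) (measurable_gaussianRatio v)]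
  congr 1
  ext x
  simp only [Pi.mul_apply, gaussianPDF]
  rw [← ENNReal.ofReal_mul (gaussianPDFReal_nonneg _ _ _)]
  congr 1
  simp only [gaussianPDFReal, gaussianRatio]
  have hv : (0 : ℝ) < 1 + v := by positivity
  push_cast
  rw [Real.sqrt_mul (by positivity), mul_one]
  have h : -(x - 0) ^ 2 / (2 * (1 + (v : ℝ)))
      = -(x - 0) ^ 2 / (2 * 1) + x ^ 2 * v / (2 * (1 + v)) := by
    field_simp
    ring
  rw [h, Real.exp_add, mul_inv]
  ring

/-- The fourth power of the affinity is `(1 + v) / (1 + v / 2) ^ 2`, so the bound reduces to `(1 + v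
/ 2) ^ 2 ≤ (1 + v) * (1 + v ^ 2 / 4)` and `1 + x ≤ exp x`. The loss is quadratic in `v`, which the
final rate depends on. -/
theorem exp_le_lintegral_gaussianRatio (v : ℝ≥0) :
    ENNReal.ofReal (Real.exp (-(v : ℝ) ^ 2 / 16))
      ≤ ∫⁻ x, ENNReal.ofReal (gaussianRatio v x) ^ (1 / 2 : ℝ) ∂(gaussianReal 0 1) := by
  have hv : (0 : ℝ) < 1 + v := by positivity
  have hv0 : (0 : ℝ) ≤ v := v.2
  set b : ℝ := (2 + v) / (4 * (1 + v)) with hb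
  have hb0 : 0 < b := by positivity
  set c : ℝ := (√(2 * Real.pi))⁻¹ * √((√(1 + v))⁻¹) with hc
  rw [gaussianReal_of_var_ne_zero 0 one_ne_zero, lintegral_withDensity_eq_lintegral_mul₀
    (measurable_gaussianPDF 0 1).aemeasurable
    ((measurable_gaussianRatio v).pow_const _).aemeasurable]
  have h1 : ∀ x, (gaussianPDF 0 1 * fun x => ENNReal.ofReal (gaussianRatio v x) ^ (1 / 2 : ℝ)) x
      = ENNReal.ofReal (c * Real.exp (-b * x ^ 2)) := by
    intro x
    simp only [Pi.mul_apply, gaussianPDF]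
    rw [ENNReal.ofReal_rpow_of_nonneg (gaussianRatio_nonneg v x) (by norm_num),
      ← ENNReal.ofReal_mul (gaussianPDFReal_nonneg _ _ _)]
    congr 1
    rw [← Real.sqrt_eq_rpow]
    simp only [gaussianPDFReal, gaussianRatio]
    rw [Real.sqrt_mul (by positivity), Real.sqrt_mul (by positivity) (Real.exp _),
      Real.sqrt_eq_rpow (Real.exp _), ← Real.exp_mul, hc]
    have h : -b * x ^ 2 = -(x - 0) ^ 2 / (2 * ((1 : ℝ≥0) : ℝ))
        + x ^ 2 * v / (2 * (1 + v)) * (1 / 2) := by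
      rw [hb]
      push_cast
      field_simp
      ring
    rw [h, Real.exp_add]
    push_cast
    ring_nf
  simp_rw [h1]
  rw [← ofReal_integral_eq_lintegral_ofReal ((integrable_exp_neg_mul_sq hb0).const_mul c)
    (Eventually.of_forall fun x => by positivity), integral_const_mul, integral_gaussian]
  refine ENNReal.ofReal_le_ofReal ?_
  refine le_of_pow_le_pow_left₀ (n := 4) (by norm_num) (by positivity) ?_
  have h4 : (c * √(Real.pi / b)) ^ 4 = (1 + v) / (1 + v / 2) ^ 2 := by
    have e1 : √(2 * Real.pi) ^ 4 = (2 * Real.pi) ^ 2 := by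
      rw [show 4 = 2 * 2 by norm_num, pow_mul, Real.sq_sqrt (by positivity)]
    have e2 : √((√(1 + (v : ℝ)))⁻¹) ^ 4 = (1 + v : ℝ)⁻¹ := by
      rw [show 4 = 2 * 2 by norm_num, pow_mul, Real.sq_sqrt (by positivity), inv_pow,
        Real.sq_sqrt (by positivity)]
    have e3 : √(Real.pi / b) ^ 4 = (Real.pi / b) ^ 2 := by
      rw [show 4 = 2 * 2 by norm_num, pow_mul, Real.sq_sqrt (by positivity)]
    rw [mul_pow, hc, mul_pow, inv_pow, e1, e2, e3, hb]
    field_simp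
    norm_num
  rw [h4, ← Real.exp_nat_mul, le_div_iff₀ (by positivity)]
  have h5 : ((4 : ℕ) : ℝ) * (-(v : ℝ) ^ 2 / 16) = -((v : ℝ) ^ 2 / 4) := by push_cast; ring
  rw [h5, Real.exp_neg, inv_mul_le_iff₀ (Real.exp_pos _)]
  have h6 := Real.add_one_le_exp ((v : ℝ) ^ 2 / 4)
  nlinarith [mul_le_mul_of_nonneg_right h6 hv.le, pow_nonneg hv0 3]

theorem lintegral_pi_prod {κ : Type*} [Fintype κ] {α : κ → Type*} [∀ i, MeasurableSpace (α i)]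
    (μ : ∀ i, Measure (α i)) [∀ i, IsProbabilityMeasure (μ i)] (f : ∀ i, α i → ℝ≥0∞)
    (hf : ∀ i, Measurable (f i)) :
    ∫⁻ x, ∏ i, f i (x i) ∂(Measure.pi μ) = ∏ i, ∫⁻ x, f i x ∂(μ i) := by
  rw [lintegral_prod_eq_prod_lintegral_of_indepFun Finset.univ (fun i (x : ∀ i, α i) => f i (x i))
    (iIndepFun_pi fun i => (hf i).aemeasurable) fun i => (hf i).comp (measurable_pi_apply i)]
  refine Finset.prod_congr rfl fun i _ => ?_
  exact (measurePreserving_eval μ i).lintegral_comp (hf i)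

theorem pi_gaussianReal_one_add_eq_withDensity {κ : Type*} [Fintype κ] (v : κ → ℝ≥0) :
    Measure.pi (fun i => gaussianReal 0 (1 + v i))
      = (Measure.pi fun _ : κ => gaussianReal 0 1).withDensity
        fun x => ∏ i, ENNReal.ofReal (gaussianRatio (v i) (x i)) := by
  refine Measure.pi_eq fun s hs => ?_
  rw [withDensity_apply _ (MeasurableSet.univ_pi hs),
    ← lintegral_indicator (MeasurableSet.univ_pi hs)]
  have h1 : ∀ i, gaussianReal 0 (1 + v i) (s i)
      = ∫⁻ x, (s i).indicator (fun x => ENNReal.ofReal (gaussianRatio (v i) x)) x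
        ∂(gaussianReal 0 1) := by
    intro i
    rw [gaussianReal_one_add_eq_withDensity, withDensity_apply _ (hs i),
      lintegral_indicator (hs i)]
  simp_rw [h1]
  rw [← lintegral_pi_prod _ _ fun i => (measurable_gaussianRatio (v i)).indicator (hs i)]
  refine lintegral_congr fun x => ?_
  by_cases hx : x ∈ Set.univ.pi s
  · rw [Set.indicator_of_mem hx]
    refine Finset.prod_congr rfl fun i _ => ?_
    rw [Set.indicator_of_mem (hx i (Set.mem_univ i))]
  · rw [Set.indicator_of_notMem hx]
    simp only [Set.mem_pi, Set.mem_univ, true_implies, not_forall] at hx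
    obtain ⟨i, hi⟩ := hx
    exact (Finset.prod_eq_zero (Finset.mem_univ i) (Set.indicator_of_notMem hi _)).symm

/-- Testing between two products of centered Gaussian laws. -/
theorem pi_gaussianReal_testing {κ : Type*} [Fintype κ] (v : κ → ℝ≥0) {B : Set (κ → ℝ)}
    (hB : MeasurableSet B) :
    ENNReal.ofReal (Real.exp (-(∑ i, (v i : ℝ) ^ 2) / 8) / 2)
      ≤ Measure.pi (fun _ : κ => gaussianReal 0 1) B
        + Measure.pi (fun i => gaussianReal 0 (1 + v i)) Bᶜ := by
  have hm : Measurable fun x : κ → ℝ => ∏ i, ENNReal.ofReal (gaussianRatio (v i) (x i)) :=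
    Finset.measurable_fun_prod _ fun i _ =>
      (measurable_gaussianRatio (v i)).comp (measurable_pi_apply i)
  have hprob : IsProbabilityMeasure ((Measure.pi fun _ : κ => gaussianReal 0 1).withDensity
      fun x => ∏ i, ENNReal.ofReal (gaussianRatio (v i) (x i))) := by
    rw [← pi_gaussianReal_one_add_eq_withDensity]; infer_instance
  have h := affinity_sq_le (Measure.pi fun _ : κ => gaussianReal 0 1) _ hm hB
  rw [← pi_gaussianReal_one_add_eq_withDensity] at h
  have h1 : ENNReal.ofReal (Real.exp (-(∑ i, (v i : ℝ) ^ 2) / 16))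
      ≤ ∫⁻ x, (∏ i, ENNReal.ofReal (gaussianRatio (v i) (x i))) ^ (1 / 2 : ℝ)
        ∂(Measure.pi fun _ : κ => gaussianReal 0 1) := by
    simp_rw [← ENNReal.prod_rpow_of_nonneg (show (0 : ℝ) ≤ 1 / 2 by norm_num)]
    rw [lintegral_pi_prod _ _ fun i => (measurable_gaussianRatio (v i)).pow_const _]
    have h2 : Real.exp (-(∑ i, (v i : ℝ) ^ 2) / 16) = ∏ i, Real.exp (-(v i : ℝ) ^ 2 / 16) := by
      rw [← Real.exp_sum, ← Finset.sum_div, Finset.sum_neg_distrib]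
    rw [h2, ENNReal.ofReal_prod_of_nonneg fun i _ => (Real.exp_pos _).le]
    exact Finset.prod_le_prod' fun i _ => exp_le_lintegral_gaussianRatio (v i)
  have h3 := (ENNReal.rpow_le_rpow h1 (show (0 : ℝ) ≤ 2 by norm_num)).trans h
  rw [ENNReal.ofReal_rpow_of_nonneg (Real.exp_pos _).le (by norm_num), ← Real.exp_mul] at h3
  have h4 : -(∑ i, (v i : ℝ) ^ 2) / 16 * 2 = -(∑ i, (v i : ℝ) ^ 2) / 8 := by ring
  rw [h4] at h3
  rw [ENNReal.ofReal_div_of_pos (by norm_num), ENNReal.div_le_iff (by simp) (by simp), mul_comm]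
  simpa using h3

end Testing

/-! ### Reduction of nested covariances to independent coordinates -/

section Diagonalization

open Matrix

variable {κ : Type*} [Fintype κ] [DecidableEq κ]

/-- A centered multivariate Gaussian law is a linear image of independent Gaussian variables. -/
theorem map_pi_gaussianReal_eq_multivariateGaussian (G : Matrix κ κ ℝ) (v : κ → ℝ≥0) :
    (Measure.pi fun i => gaussianReal 0 (v i)).map (fun x => WithLp.toLp 2 (G *ᵥ x))
      = multivariateGaussian 0 (G * diagonal (fun i => (v i : ℝ)) * Gᵀ) := by
  have hpsd : (G * diagonal (fun i => (v i : ℝ)) * Gᵀ).PosSemidef := by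
    have := (PosSemidef.diagonal (n := κ) (d := fun i => (v i : ℝ)) fun i => (v i).2)
      |>.mul_mul_conjTranspose_same G
    simpa [conjTranspose_eq_transpose_of_trivial] using this
  have hmeas : Measurable fun x : κ → ℝ => WithLp.toLp 2 (G *ᵥ x) := by
    have : Continuous fun x : κ → ℝ => WithLp.toLp 2 (G *ᵥ x) := by fun_prop
    exact this.measurable
  have := Measure.isProbabilityMeasure_map (μ := Measure.pi fun i => gaussianReal 0 (v i))
    hmeas.aemeasurable
  refine Measure.ext_of_charFun ?_
  ext t
  rw [charFun_multivariateGaussian hpsd, charFun_apply, integral_map hmeas.aemeasurable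
    (Measurable.aestronglyMeasurable (by fun_prop))]
  have h1 : ∀ x : κ → ℝ, Complex.exp ((inner ℝ (WithLp.toLp 2 (G *ᵥ x)) t : ℝ) * Complex.I)
      = ∏ i, Complex.exp (((Gᵀ *ᵥ t) i : ℝ) * (x i : ℝ) * Complex.I) := by
    intro x
    rw [← Complex.exp_sum]
    congr 1
    have : (inner ℝ (WithLp.toLp 2 (G *ᵥ x)) t : ℝ) = ∑ i, (Gᵀ *ᵥ t) i * x i := by
      rw [EuclideanSpace.inner_eq_star_dotProduct, star_trivial]
      change t.ofLp ⬝ᵥ G *ᵥ x = (Gᵀ *ᵥ t.ofLp) ⬝ᵥ x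
      rw [dotProduct_mulVec, mulVec_transpose]
    rw [this]
    push_cast
    rw [Finset.sum_mul]
  simp_rw [h1]
  rw [integral_fintype_prod_eq_prod
    (f := fun i (y : ℝ) => Complex.exp (((Gᵀ *ᵥ t) i : ℝ) * (y : ℝ) * Complex.I))]
  simp_rw [← charFun_apply_real, charFun_gaussianReal]
  rw [← Complex.exp_sum]
  congr 1
  have h2 : t.ofLp ⬝ᵥ (G * diagonal (fun i => (v i : ℝ)) * Gᵀ) *ᵥ t.ofLp
      = ∑ i, v i * (Gᵀ *ᵥ t) i ^ 2 := by
    rw [← mulVec_mulVec, ← mulVec_mulVec, dotProduct_mulVec, ← mulVec_transpose]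
    simp only [dotProduct, mulVec_diagonal]
    exact Finset.sum_congr rfl fun i _ => by ring
  rw [h2]
  simp [Finset.sum_div]

/-- Simultaneous diagonalization of a positive definite and a positive semidefinite matrix. -/
theorem exists_simultaneous_diagonalization (S D : Matrix κ κ ℝ) (hS : S.PosDef)
    (hD : D.PosSemidef) {k : ℝ} (hk : (k • S - D).PosSemidef) :
    ∃ (G : Matrix κ κ ℝ) (v : κ → ℝ≥0), S = G * Gᵀ ∧
      D = G * diagonal (fun i => (v i : ℝ)) * Gᵀ ∧ (∀ i, (v i : ℝ) ≤ k) ∧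
      ∑ i, (v i : ℝ) = (S⁻¹ * D).trace := by
  open scoped MatrixOrder in
  -- With `A = √S` and `A⁻¹ * D * A⁻¹ = U * Λ * Uᵀ`, the common factor is `G = A * U` and the `v i`
  -- are the diagonal entries of `Λ`. Conjugating `k • S - D` by `A⁻¹` bounds them by `k`.
  set A := CFC.sqrt S with hAdef
  have hA : A.PosSemidef := by
    rw [← nonneg_iff_posSemidef]; exact CFC.sqrt_nonneg S
  have hAA : A * A = S := CFC.sqrt_mul_sqrt_self S hS.posSemidef.nonneg
  have hAT : Aᵀ = A := by
    rw [← conjTranspose_eq_transpose_of_trivial]; exact hA.isHermitian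
  have hdet : IsUnit A.det := by
    have : IsUnit S.det := hS.det_pos.ne'.isUnit
    rw [← hAA, det_mul] at this
    exact isUnit_of_mul_isUnit_left this
  have hAiT : (A⁻¹)ᵀ = A⁻¹ := by rw [transpose_nonsing_inv, hAT]
  have hM : (A⁻¹ * D * A⁻¹).PosSemidef := by
    have := hD.mul_mul_conjTranspose_same A⁻¹
    rwa [conjTranspose_eq_transpose_of_trivial, hAiT] at this
  have hkM : (k • (1 : Matrix κ κ ℝ) - A⁻¹ * D * A⁻¹).PosSemidef := by
    have := hk.mul_mul_conjTranspose_same A⁻¹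
    rw [conjTranspose_eq_transpose_of_trivial, hAiT, mul_sub, sub_mul] at this
    convert this using 2
    rw [← hAA, mul_smul_comm, smul_mul_assoc, nonsing_inv_mul_cancel_left _ _ hdet,
      mul_nonsing_inv _ hdet]
  have hH := hM.isHermitian
  let U : Matrix κ κ ℝ := hH.eigenvectorUnitary
  have hUU : U * Uᵀ = 1 := by
    have := Unitary.mul_star_self_of_mem hH.eigenvectorUnitary.2
    rwa [star_eq_conjTranspose, conjTranspose_eq_transpose_of_trivial] at this
  have hUU' : Uᵀ * U = 1 := by
    have := Unitary.star_mul_self_of_mem hH.eigenvectorUnitary.2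
    rwa [star_eq_conjTranspose, conjTranspose_eq_transpose_of_trivial] at this
  have hspec : A⁻¹ * D * A⁻¹ = U * diagonal hH.eigenvalues * Uᵀ := by
    have := hH.spectral_theorem
    rw [Unitary.conjStarAlgAut_apply] at this
    rw [star_eq_conjTranspose, conjTranspose_eq_transpose_of_trivial] at this
    exact this
  refine ⟨A * U, fun i => ⟨hH.eigenvalues i, hM.eigenvalues_nonneg i⟩, ?_, ?_, fun i => ?_, ?_⟩
  · rw [transpose_mul, hAT, Matrix.mul_assoc, ← Matrix.mul_assoc U, hUU, Matrix.one_mul, hAA]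
  · rw [transpose_mul, hAT]
    change D = A * U * diagonal hH.eigenvalues * (Uᵀ * A)
    have : A * U * diagonal hH.eigenvalues * (Uᵀ * A)
        = A * (U * diagonal hH.eigenvalues * Uᵀ) * A := by simp only [Matrix.mul_assoc]
    rw [this, ← hspec, Matrix.mul_assoc, Matrix.mul_assoc, nonsing_inv_mul _ hdet, Matrix.mul_one,
      mul_nonsing_inv_cancel_left _ _ hdet]
  · change hH.eigenvalues i ≤ k
    generalize hH.eigenvalues = lam at hspec ⊢
    have h1 : Uᵀ * (k • (1 : Matrix κ κ ℝ) - A⁻¹ * D * A⁻¹) * U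
        = diagonal (fun i => k - lam i) := by
      rw [hspec, Matrix.mul_sub, Matrix.sub_mul]
      have : Uᵀ * (U * diagonal lam * Uᵀ) * U
          = (Uᵀ * U) * diagonal lam * (Uᵀ * U) := by simp only [Matrix.mul_assoc]
      rw [this, hUU']
      simp only [mul_smul_comm, smul_mul_assoc, Matrix.mul_one, Matrix.one_mul, hUU']
      rw [← diagonal_one, ← diagonal_smul, diagonal_sub]
      simp
    have h2 := hkM.conjTranspose_mul_mul_same U
    rw [conjTranspose_eq_transpose_of_trivial, h1] at h2
    have h3 := h2.diag_nonneg (i := i)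
    simpa using h3
  · have h1 := hH.trace_eq_sum_eigenvalues
    have h2 : (S⁻¹ * D).trace = (A⁻¹ * D * A⁻¹).trace := by
      rw [← hAA, Matrix.mul_inv_rev, Matrix.mul_assoc, trace_mul_comm A⁻¹]
    rw [h2, h1]
    rfl

/-- Testing between two centered multivariate Gaussian laws with nested covariances. -/
theorem multivariateGaussian_testing (S D : Matrix κ κ ℝ) (hS : S.PosDef) (hD : D.PosSemidef)
    {k τ : ℝ} (hk0 : 0 ≤ k) (hk : (k • S - D).PosSemidef) (hτ : (S⁻¹ * D).trace ≤ τ)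
    {B : Set (EuclideanSpace ℝ κ)} (hB : MeasurableSet B) :
    ENNReal.ofReal (Real.exp (-(k * τ) / 8) / 2)
      ≤ multivariateGaussian 0 S B + multivariateGaussian 0 (S + D) Bᶜ := by
  obtain ⟨G, v, hG, hDv, hv, htr⟩ := exists_simultaneous_diagonalization S D hS hD hk
  have hmeas : Measurable fun x : κ → ℝ => WithLp.toLp 2 (G *ᵥ x) := by
    have : Continuous fun x : κ → ℝ => WithLp.toLp 2 (G *ᵥ x) := by fun_prop
    exact this.measurable
  -- Both laws are images of product laws under the same linear map, so a test on the data pulls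
  -- back to a test in independent coordinates.
  have h0 : multivariateGaussian 0 S = (Measure.pi fun _ : κ => gaussianReal 0 1).map
      (fun x => WithLp.toLp 2 (G *ᵥ x)) := by
    rw [map_pi_gaussianReal_eq_multivariateGaussian G fun _ => 1, hG]
    simp
  have h1 : multivariateGaussian 0 (S + D) = (Measure.pi fun i => gaussianReal 0 (1 + v i)).map
      (fun x => WithLp.toLp 2 (G *ᵥ x)) := by
    rw [map_pi_gaussianReal_eq_multivariateGaussian G fun i => 1 + v i, hDv, hG]
    congr 1
    push_cast
    rw [← diagonal_add, diagonal_one, Matrix.mul_add, Matrix.add_mul, Matrix.mul_one]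
  rw [h0, h1, Measure.map_apply hmeas hB, Measure.map_apply hmeas hB.compl]
  refine le_trans (ENNReal.ofReal_le_ofReal ?_) (pi_gaussianReal_testing v (hmeas hB))
  have : ∑ i, (v i : ℝ) ^ 2 ≤ k * τ := by
    calc ∑ i, (v i : ℝ) ^ 2 ≤ ∑ i, k * (v i : ℝ) := Finset.sum_le_sum fun i _ => by
          rw [sq]; exact mul_le_mul_of_nonneg_right (hv i) (v i).2
      _ = k * (S⁻¹ * D).trace := by rw [← Finset.mul_sum, htr]
      _ ≤ k * τ := mul_le_mul_of_nonneg_left hτ hk0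
  gcongr

end Diagonalization

end SpectralMinimax

namespace SpectralMinimax

/-! ### Moments and finite-dimensional laws of path measures -/

section PathLaw

variable {T : Type} {K : T → T → ℝ}

/-- `P` is the law on path space of a centered Gaussian process with covariance kernel `K`. -/
def IsCenteredGaussianPathLaw (K : T → T → ℝ) (P : Measure (T → ℝ)) : Prop :=
  IsProbabilityMeasure P ∧ ∀ (κ : Type) (_ : Fintype κ) (_ : DecidableEq κ) (t : κ → T),
    P.map (fun ω => WithLp.toLp 2 fun k => ω (t k))
      = multivariateGaussian 0 (Matrix.of fun k l => K (t k) (t l))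

/-- The points `t k` may repeat, so positivity over finsets does not apply directly; through the
feature map the quadratic form is a squared norm. -/
theorem posSemidef_of_kernel (symm : ∀ s t, K s t = K t s)
    (nonneg : ∀ (I : Finset T) (a : T → ℝ), 0 ≤ ∑ s ∈ I, ∑ t ∈ I, a s * a t * K s t)
    {κ : Type} [Fintype κ] (t : κ → T) :
    (Matrix.of fun k l => K (t k) (t l)).PosSemidef := by
  obtain ⟨E, _, _, _, φ, hφ⟩ := exists_featureMap K symm nonneg
  refine Matrix.PosSemidef.of_dotProduct_mulVec_nonneg ?_ fun a => ?_
  · refine Matrix.IsHermitian.ext fun i j => ?_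
    simp [symm (t i)]
  · have h : star a ⬝ᵥ (Matrix.of fun k l => K (t k) (t l)).mulVec a
        = ‖∑ k, a k • φ (t k)‖ ^ 2 := by
      rw [← real_inner_self_eq_norm_sq, sum_inner]
      simp_rw [inner_sum, real_inner_smul_left, real_inner_smul_right, hφ]
      simp only [dotProduct, Matrix.mulVec, Pi.star_apply, star_trivial, Matrix.of_apply,
        Finset.mul_sum]
      refine Finset.sum_congr rfl fun k _ => Finset.sum_congr rfl fun l _ => by ring
    rw [h]
    positivity

theorem exists_isCenteredGaussianPathLaw (symm : ∀ s t, K s t = K t s)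
    (nonneg : ∀ (I : Finset T) (a : T → ℝ), 0 ≤ ∑ s ∈ I, ∑ t ∈ I, a s * a t * K s t) :
    ∃ P : Measure (T → ℝ), IsCenteredGaussianPathLaw K P := by
  obtain ⟨P, hP, h⟩ := exists_gaussian_path_measure K symm nonneg
  refine ⟨P, hP, fun κ _ _ t => ?_⟩
  have hm : Measurable fun ω : T → ℝ => WithLp.toLp 2 fun k => ω (t k) := by fun_prop
  have := Measure.isProbabilityMeasure_map (μ := P) hm.aemeasurable
  refine Measure.ext_of_charFun ?_
  ext a
  rw [charFun_multivariateGaussian (posSemidef_of_kernel symm nonneg t), charFun_apply,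
    integral_map hm.aemeasurable (Measurable.aestronglyMeasurable (by fun_prop))]
  have h1 := h κ inferInstance t a
  convert h1 using 2
  · ext ω
    congr 1
    rw [mul_comm, PiLp.inner_apply]
    congr 2
  · simp only [inner_zero_right, Complex.ofReal_zero, zero_mul, zero_sub]
    rw [neg_mul, one_div_mul_eq_div]
    congr 3
    simp only [dotProduct, Matrix.mulVec, Matrix.of_apply, Finset.mul_sum]
    refine Finset.sum_congr rfl fun k _ => Finset.sum_congr rfl fun l _ => by ring

variable {P : Measure (T → ℝ)}

theorem IsCenteredGaussianPathLaw.memLp (hP : IsCenteredGaussianPathLaw K P) (t : T) :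
    MemLp (fun ω : T → ℝ => ω t) 2 P := by
  have hm : Measurable fun ω : T → ℝ => WithLp.toLp 2 fun _ : Fin 1 => ω t := by fun_prop
  have h := hP.2 (Fin 1) inferInstance inferInstance fun _ => t
  have h2 : MemLp (fun x : EuclideanSpace ℝ (Fin 1) => x 0) 2
      (P.map fun ω => WithLp.toLp 2 fun _ : Fin 1 => ω t) := by
    rw [h]
    exact (IsGaussian.memLp_two_id).continuousLinearMap_comp
      (EuclideanSpace.proj (0 : Fin 1) : EuclideanSpace ℝ (Fin 1) →L[ℝ] ℝ)
  exact (memLp_map_measure_iff (by fun_prop) hm.aemeasurable).mp h2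

theorem IsCenteredGaussianPathLaw.integral_eval (hP : IsCenteredGaussianPathLaw K P) (t : T) :
    ∫ ω, ω t ∂P = 0 := by
  have hm : Measurable fun ω : T → ℝ => WithLp.toLp 2 fun _ : Fin 1 => ω t := by fun_prop
  have h := hP.2 (Fin 1) inferInstance inferInstance fun _ => t
  have h2 := integral_map hm.aemeasurable (μ := P)
    (f := fun x : EuclideanSpace ℝ (Fin 1) => x 0) (by fun_prop)
  rw [h] at h2
  change _ = ∫ ω, ω t ∂P at h2
  rw [← h2]
  have h3 := ContinuousLinearMap.integral_comp_id_comm (μ := multivariateGaussian 0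
    (Matrix.of fun _ _ : Fin 1 => K t t)) (IsGaussian.integrable_id)
    (EuclideanSpace.proj (0 : Fin 1) : EuclideanSpace ℝ (Fin 1) →L[ℝ] ℝ)
  simpa using h3

theorem IsCenteredGaussianPathLaw.integral_mul (hP : IsCenteredGaussianPathLaw K P)
    (hpsd : ∀ t : Fin 2 → T, (Matrix.of fun k l => K (t k) (t l)).PosSemidef) (s t : T) :
    ∫ ω, ω s * ω t ∂P = K s t := by
  have := hP.1
  have hm : Measurable fun ω : T → ℝ => WithLp.toLp 2 fun k : Fin 2 => ω (![s, t] k) := by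
    fun_prop
  have h := hP.2 (Fin 2) inferInstance inferInstance ![s, t]
  have h2 := covariance_eval_multivariateGaussian (μ := 0) (hpsd ![s, t]) 0 1
  rw [← h, covariance_map (by fun_prop) (by fun_prop) hm.aemeasurable] at h2
  change cov[fun ω => ω s, fun ω => ω t; P] = K s t at h2
  rw [← h2, covariance_eq_sub (hP.memLp s) (hP.memLp t), hP.integral_eval, zero_mul, sub_zero]
  rfl

end PathLaw

/-! ### Processes along a single vector of the Hilbert space -/

section HilbertValued

variable {ι H : Type*} [NormedAddCommGroup H] [InnerProductSpace ℂ H] {d : ℕ}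

/-- The path with values on the real line through `u`. -/
def linePath (u : H) (ω : Space d → ℝ) : Space d → H := fun t => ((ω t : ℝ) : ℂ) • u

theorem outer_ofReal_smul (u : H) (a b : ℝ) :
    outer ((a : ℂ) • u) ((b : ℂ) • u) = ((a * b : ℝ) : ℂ) • outer u u := by
  ext z
  simp only [outer, InnerProductSpace.rankOne_apply, inner_smul_left, smul_smul,
    FunLike.coe_smul, Pi.smul_apply, Complex.conj_ofReal]
  push_cast
  ring_nf

theorem continuous_outer : Continuous fun p : H × H => outer p.1 p.2 := by
  exact ((ContinuousLinearMap.smulRightL ℂ H H).continuous.comp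
    ((innerSL ℂ).continuous.comp continuous_snd)).clm_apply continuous_fst

theorem isClosed_isRealElement (e : HilbertBasis ι ℂ H) : IsClosed {x | IsRealElement e x} := by
  unfold IsRealElement
  rw [Set.ofPred_forall]
  refine isClosed_iInter fun j => isClosed_eq ?_ continuous_const
  simp_rw [HilbertBasis.repr_apply_apply]
  fun_prop

variable [MeasurableSpace H] [BorelSpace H]

theorem measurable_linePath (u : H) : Measurable (linePath (d := d) u) := by
  refine measurable_pi_lambda _ fun t => ?_
  have : Continuous fun y : ℝ => ((y : ℝ) : ℂ) • u := by fun_prop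
  exact this.measurable.comp (measurable_pi_apply t)

variable [TopologicalSpace.SeparableSpace H]

/-- Taking a basis vector as direction makes the process real: its coordinates are the scalar
process in place `j` and zero elsewhere. -/
theorem isStationaryProcess_linePath [CompleteSpace H] (e : HilbertBasis ι ℂ H) (j : ι)
    {g : Space d → ℝ}
    {P : Measure (Space d → ℝ)} (hP : IsCenteredGaussianPathLaw (fun s t => g (s - t)) P)
    (hpsd : ∀ t : Fin 2 → Space d, (Matrix.of fun k l => g (t k - t l)).PosSemidef) :
    IsStationaryProcess e (fun t ω => ω t) (P.map (linePath (e j)))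
      fun h => (g h : ℂ) • outer (e j) (e j) := by
  have := hP.1
  have hm := measurable_linePath (d := d) (e j)
  have : SecondCountableTopology H := UniformSpace.secondCountable_of_separable H
  refine ⟨Measure.isProbabilityMeasure_map hm.aemeasurable, fun t => ?_, fun t => ?_, fun t => ?_,
    fun t h => ?_⟩
  · rw [memLp_map_measure_iff (Measurable.aestronglyMeasurable (by fun_prop)) hm.aemeasurable]
    have h1 : MemLp (fun ω : Space d → ℝ => (((ω t : ℝ) : ℂ))) 2 P := (hP.memLp t).ofReal
    exact h1.continuousLinearMap_comp ((ContinuousLinearMap.id ℂ ℂ).smulRight (e j))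
  · rw [integral_map hm.aemeasurable (Measurable.aestronglyMeasurable (by fun_prop))]
    change ∫ ω, ((ω t : ℝ) : ℂ) • e j ∂P = 0
    rw [integral_smul_const, integral_complex_ofReal, hP.integral_eval]
    simp
  · refine (ae_map_iff hm.aemeasurable ?_).mpr (Eventually.of_forall fun ω i => ?_)
    · exact (isClosed_isRealElement e).measurableSet.preimage (measurable_pi_apply t)
    · classical
      simp only [linePath, HilbertBasis.repr_apply_apply, inner_smul_right]
      rw [orthonormal_iff_ite.mp e.orthonormal i j]
      split_ifs <;> simp
  · rw [integral_map hm.aemeasurable]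
    · simp only [linePath]
      simp_rw [outer_ofReal_smul]
      rw [integral_smul_const, integral_complex_ofReal, hP.integral_mul hpsd]
      simp
    · have h1 : Measurable fun ω : Space d → H => (ω (t + h), ω t) := by fun_prop
      exact (continuous_outer.comp_stronglyMeasurable h1.stronglyMeasurable).aestronglyMeasurable

theorem isGaussianProcess_linePath (u : H)
    {K : Space d → Space d → ℝ} {P : Measure (Space d → ℝ)} (hP : IsCenteredGaussianPathLaw K P) :
    IsGaussianProcess (fun (t : Space d) (ω : Space d → H) => ω t) (P.map (linePath u)) := by
  classical
  have : SecondCountableTopology H := UniformSpace.secondCountable_of_separable H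
  have hm := measurable_linePath (d := d) u
  refine ⟨fun I => ⟨?_⟩⟩
  let L : EuclideanSpace ℝ I →L[ℝ] (I → H) := ContinuousLinearMap.pi fun t =>
    (Complex.ofRealCLM.smulRight u) ∘L (EuclideanSpace.proj t : EuclideanSpace ℝ I →L[ℝ] ℝ)
  have hI : Measurable fun ω : Space d → ℝ => WithLp.toLp 2 fun k : I => ω k := by fun_prop
  have h1 : (P.map (linePath u)).map (fun ω => I.restrict fun t => ω t)
      = (P.map fun ω => WithLp.toLp 2 fun k : I => ω k).map L := by
    rw [Measure.map_map (Finset.measurable_restrict I) hm, Measure.map_map L.measurable hI]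
    rfl
  rw [h1, hP.2 I inferInstance inferInstance fun k => (k : Space d)]
  infer_instance

end HilbertValued

end SpectralMinimax

namespace SpectralMinimax

/-! ### Trace and Hilbert–Schmidt norms of rank-one operators -/

section Norms

variable {ι H : Type*} [NormedAddCommGroup H] [InnerProductSpace ℂ H] [CompleteSpace H]

theorem traceNorm_of_nonneg (e : HilbertBasis ι ℂ H) {A : H →L[ℂ] H} (hA : 0 ≤ A) :
    traceNorm e A = ∑' j, ENNReal.ofReal (inner ℂ (e j) (A (e j))).re := by
  have hs : star A = A := hA.isSelfAdjoint
  unfold traceNorm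
  rw [hs, CFC.sqrt_mul_self A hA]

/-- The trace norm sees an operator `A` only through `A* A`, so `c` may be replaced by `|c|`. The
operator is then positive, equals its own modulus, and has a single nonzero diagonal entry. -/
theorem traceNorm_ofReal_smul_outer (e : HilbertBasis ι ℂ H) (j : ι) (c : ℝ) :
    traceNorm e ((c : ℂ) • outer (e j) (e j)) = ENNReal.ofReal |c| := by
  classical
  have hP : (0 : H →L[ℂ] H) ≤ outer (e j) (e j) := by
    rw [ContinuousLinearMap.nonneg_iff_isPositive]
    exact InnerProductSpace.isPositive_rankOne_self _
  have hcP : (0 : H →L[ℂ] H) ≤ ((|c| : ℝ) : ℂ) • outer (e j) (e j) := by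
    rw [ContinuousLinearMap.nonneg_iff_isPositive] at hP ⊢
    exact hP.smul_of_nonneg (by exact_mod_cast abs_nonneg c)
  have hs : star (outer (e j) (e j)) = outer (e j) (e j) := hP.isSelfAdjoint
  have h1 : traceNorm e ((c : ℂ) • outer (e j) (e j))
      = traceNorm e (((|c| : ℝ) : ℂ) • outer (e j) (e j)) := by
    unfold traceNorm
    simp only [star_smul, hs, smul_mul_smul_comm]
    have : star (c : ℂ) * c = star ((|c| : ℝ) : ℂ) * ((|c| : ℝ) : ℂ) := by
      simp only [RCLike.star_def, Complex.conj_ofReal]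
      norm_cast
      exact (abs_mul_abs_self c).symm
    rw [this]
  rw [h1, traceNorm_of_nonneg e hcP, tsum_eq_single j]
  · simp [outer, InnerProductSpace.rankOne_apply, inner_self_eq_norm_sq_to_K, e.orthonormal.1 j]
  · intro i hi
    have h2 : inner ℂ (e j) (e i) = 0 := by
      rw [orthonormal_iff_ite.mp e.orthonormal j i, if_neg (Ne.symm hi)]
    simp [outer, InnerProductSpace.rankOne_apply, h2]

/-- The Hilbert-Schmidt norm dominates every diagonal matrix element. -/
theorem ofReal_norm_inner_le_hsNorm (e : HilbertBasis ι ℂ H) (j : ι) (A : H →L[ℂ] H) :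
    ENNReal.ofReal ‖inner ℂ (e j) (A (e j))‖ ≤ hsNorm e A := by
  unfold hsNorm
  rw [traceNorm_of_nonneg e (star_mul_self_nonneg A)]
  have h1 : ENNReal.ofReal (‖inner ℂ (e j) (A (e j))‖ ^ 2)
      ≤ ∑' i, ENNReal.ofReal (inner ℂ (e i) ((star A * A) (e i))).re := by
    refine le_trans ?_ (ENNReal.le_tsum j)
    refine ENNReal.ofReal_le_ofReal ?_
    have h2 : inner ℂ (e j) ((star A * A) (e j)) = inner ℂ (A (e j)) (A (e j)) := by
      rw [ContinuousLinearMap.star_eq_adjoint]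
      simp [ContinuousLinearMap.adjoint_inner_right]
    rw [h2, inner_self_eq_norm_sq_to_K]
    norm_cast
    refine pow_le_pow_left₀ (norm_nonneg _) ?_ 2
    refine (norm_inner_le_norm _ _).trans_eq ?_
    rw [e.orthonormal.1 j, one_mul]
  calc ENNReal.ofReal ‖inner ℂ (e j) (A (e j))‖
      = ENNReal.ofReal (‖inner ℂ (e j) (A (e j))‖ ^ 2) ^ (1 / 2 : ℝ) := by
        rw [ENNReal.ofReal_rpow_of_nonneg (by positivity) (by norm_num), ← Real.sqrt_eq_rpow,
          Real.sqrt_sq (norm_nonneg _)]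
    _ ≤ _ := ENNReal.rpow_le_rpow h1 (by norm_num)

end Norms

/-! ### Reduction of the minimax risk to a scalar test -/

section TwoPoint

variable {d : ℕ}

/-- The scalar spectral transform `(2π)^{-d} ∫ exp(i xᵀ θ) g x dx`. -/
noncomputable def scalarTransform (g : Space d → ℝ) (θ : Space d) : ℂ :=
  ((((2 * Real.pi) ^ d)⁻¹ : ℝ) : ℂ) *
    ∫ x : Space d, Complex.exp (Complex.I * ((inner ℝ x θ : ℝ) : ℂ)) * (g x : ℂ)

/-- A scalar stationary covariance function in the class with parameters `β`, `L`. -/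
structure IsAdmissible (β L : ℝ) (g : Space d → ℝ) : Prop where
  symm : ∀ x, g (-x) = g x
  nonneg : ∀ (I : Finset (Space d)) (a : Space d → ℝ), 0 ≤ ∑ s ∈ I, ∑ t ∈ I, a s * a t * g (s - t)
  continuous : Continuous g
  lintegral_le : ∫⁻ x, ENNReal.ofReal (1 + ‖x‖ ^ β) * ENNReal.ofReal |g x| ≤ ENNReal.ofReal L

namespace IsAdmissible

variable {β L : ℝ} {g : Space d → ℝ}

theorem symm_sub (hg : IsAdmissible β L g) (s t : Space d) : g (s - t) = g (t - s) := by
  rw [← hg.symm, neg_sub]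

theorem posSemidef (hg : IsAdmissible β L g) {κ : Type} [Fintype κ] (t : κ → Space d) :
    (Matrix.of fun k l => g (t k - t l)).PosSemidef :=
  posSemidef_of_kernel (K := fun s t => g (s - t)) hg.symm_sub hg.nonneg t

theorem lintegral_lt_top (hg : IsAdmissible β L g) : ∫⁻ x, ENNReal.ofReal |g x| < ∞ := by
  refine lt_of_le_of_lt (lintegral_mono fun x => ?_)
    (hg.lintegral_le.trans_lt ENNReal.ofReal_lt_top)
  refine le_mul_of_one_le_left' ?_
  rw [← ENNReal.ofReal_one]
  exact ENNReal.ofReal_le_ofReal (le_add_of_nonneg_right (Real.rpow_nonneg (norm_nonneg _) _))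

variable {ι H : Type*} [NormedAddCommGroup H] [InnerProductSpace ℂ H]

/-- The operator-valued covariance function. -/
noncomputable def operatorCovariance (u : H) (g : Space d → ℝ) (x : Space d) : H →L[ℂ] H :=
  (g x : ℂ) • outer u u

theorem spectralTransform_operatorCovariance [CompleteSpace H] (u : H) (g : Space d → ℝ)
    (θ : Space d) :
    spectralTransform (operatorCovariance u g) θ = scalarTransform g θ • outer u u := by
  unfold spectralTransform operatorCovariance scalarTransform
  simp_rw [smul_smul]
  rw [integral_smul_const, smul_smul]

theorem inner_spectralTransform [CompleteSpace H] {u : H} (hu : ‖u‖ = 1) (g : Space d → ℝ)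
    (θ : Space d) :
    inner ℂ u (spectralTransform (operatorCovariance u g) θ u) = scalarTransform g θ := by
  rw [spectralTransform_operatorCovariance]
  simp [outer, InnerProductSpace.rankOne_apply, inner_self_eq_norm_sq_to_K, hu]

variable [CompleteSpace H]

theorem tendsto_traceNorm (hg : IsAdmissible β L g) (e : HilbertBasis ι ℂ H) (j : ι) :
    Tendsto (fun h => traceNorm e (operatorCovariance (e j) g h - operatorCovariance (e j) g 0))
      (𝓝 0) (𝓝 0) := by
  have h1 : ∀ h, traceNorm e (operatorCovariance (e j) g h - operatorCovariance (e j) g 0)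
      = ENNReal.ofReal |g h - g 0| := by
    intro h
    rw [← traceNorm_ofReal_smul_outer e j]
    congr 1
    unfold operatorCovariance
    push_cast
    rw [sub_smul]
  simp_rw [h1]
  have h2 : Continuous fun h => ENNReal.ofReal |g h - g 0| :=
    ENNReal.continuous_ofReal.comp ((hg.continuous.sub continuous_const).abs)
  simpa using h2.tendsto 0

variable [MeasurableSpace H] [BorelSpace H] [TopologicalSpace.SeparableSpace H]

theorem mem_powerLawClass (hg : IsAdmissible β L g) (e : HilbertBasis ι ℂ H) (j : ι) :
    spectralTransform (operatorCovariance (e j) g) ∈ powerLawClass e d β L := by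
  obtain ⟨P, hP⟩ := exists_isCenteredGaussianPathLaw (K := fun s t => g (s - t))
    hg.symm_sub hg.nonneg
  refine ⟨_, ⟨_, isStationaryProcess_linePath e j hP hg.posSemidef⟩, hg.tendsto_traceNorm e j, ?_,
    rfl⟩
  simp_rw [traceNorm_ofReal_smul_outer]
  exact hg.lintegral_le

theorem isStationaryGaussianLaw (hg : IsAdmissible β L g) (e : HilbertBasis ι ℂ H) (j : ι)
    {P : Measure (Space d → ℝ)} (hP : IsCenteredGaussianPathLaw (fun s t => g (s - t)) P) :
    IsStationaryGaussianLaw e (P.map (linePath (e j)))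
      (spectralTransform (operatorCovariance (e j) g)) := by
  refine ⟨isGaussianProcess_linePath (e j) hP, _, isStationaryProcess_linePath e j hP hg.posSemidef,
    hg.tendsto_traceNorm e j, ?_, rfl⟩
  simp_rw [traceNorm_ofReal_smul_outer]
  exact hg.lintegral_lt_top

end IsAdmissible

/-- The covariance matrix of the observations on the grid. -/
def gridMatrix (n : ℕ) (δ : ℝ) (g : Space d → ℝ) : Matrix (Fin d → Fin n) (Fin d → Fin n) ℝ :=
  Matrix.of fun k l => g (gridPoint δ k - gridPoint δ l)

variable {ι H : Type*} [NormedAddCommGroup H] [InnerProductSpace ℂ H] [MeasurableSpace H]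
  [BorelSpace H]

theorem measurableSet_error_ge {n : ℕ} {T : ((Fin d → Fin n) → H) → Space d → H →L[ℂ] H}
    (hT : T ∈ estimators H d n) (u : H) (θ₀ : Space d) (r : ℝ) (s : ℂ) :
    MeasurableSet {y : EuclideanSpace ℝ (Fin d → Fin n) |
      r ≤ ‖inner ℂ u (T (fun k => ((y k : ℝ) : ℂ) • u) θ₀ u) - s‖} := by
  have h1 : Measurable fun (y : EuclideanSpace ℝ (Fin d → Fin n)) (k : Fin d → Fin n) =>
      ((y k : ℝ) : ℂ) • u := by
    refine measurable_pi_lambda _ fun k => ?_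
    have h2 : Continuous fun y : EuclideanSpace ℝ (Fin d → Fin n) => ((y k : ℝ) : ℂ) • u := by
      fun_prop
    exact h2.measurable
  exact measurableSet_le measurable_const ((((hT θ₀ u u).comp h1).sub_const _).norm)

variable [CompleteSpace H] [TopologicalSpace.SeparableSpace H]

/-- The supremum is bounded below by one explicit law. The Hilbert–Schmidt error event need not be
measurable, so it is bounded below through the event that the `(j, j)` matrix element has error at
least `r`, which it contains. -/
theorem measure_le_iSup {β L : ℝ} {g : Space d → ℝ} (hg : IsAdmissible β L g)
    (e : HilbertBasis ι ℂ H) (j : ι) {n : ℕ} (δ r : ℝ) (θ₀ : Space d)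
    {T : ((Fin d → Fin n) → H) → Space d → H →L[ℂ] H} (hT : T ∈ estimators H d n) :
    multivariateGaussian 0 (gridMatrix n δ g)
        {y | r ≤ ‖inner ℂ (e j) (T (fun k => ((y k : ℝ) : ℂ) • e j) θ₀ (e j))
          - scalarTransform g θ₀‖}
      ≤ ⨆ f ∈ powerLawClass e d β L,
          ⨆ (P : Measure (Space d → H)) (_ : IsStationaryGaussianLaw e P f),
            P {ω | ENNReal.ofReal r ≤ hsNorm e (T (observations n δ ω) θ₀ - f θ₀)} := by
  obtain ⟨P, hP⟩ := exists_isCenteredGaussianPathLaw (K := fun s t => g (s - t))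
    hg.symm_sub hg.nonneg
  refine le_trans ?_ (le_iSup₂_of_le _ (hg.mem_powerLawClass e j)
    (le_iSup₂_of_le _ (hg.isStationaryGaussianLaw e j hP) le_rfl))
  have hlaw := hP.2 (Fin d → Fin n) inferInstance inferInstance (gridPoint δ)
  have hm : Measurable fun ω : Space d → ℝ =>
      WithLp.toLp 2 fun k : Fin d → Fin n => ω (gridPoint δ k) := by fun_prop
  have hS : MeasurableSet {ω : Space d → H |
      r ≤ ‖inner ℂ (e j) (T (observations n δ ω) θ₀ (e j)) - scalarTransform g θ₀‖} := by
    have h1 : Measurable fun ω : Space d → H => observations n δ ω :=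
      measurable_pi_lambda _ fun k => measurable_pi_apply _
    exact measurableSet_le measurable_const
      ((((hT θ₀ (e j) (e j)).comp h1).sub_const _).norm)
  refine le_trans ?_ (measure_mono (s := {ω : Space d → H |
      r ≤ ‖inner ℂ (e j) (T (observations n δ ω) θ₀ (e j)) - scalarTransform g θ₀‖}) ?_)
  · rw [Measure.map_apply (measurable_linePath _) hS]
    change multivariateGaussian 0 (Matrix.of fun k l => g (gridPoint δ k - gridPoint δ l)) _ ≤ _
    rw [← hlaw, Measure.map_apply hm
      (measurableSet_error_ge hT (e j) θ₀ r (scalarTransform g θ₀))]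
    rfl
  · intro ω hω
    refine le_trans (ENNReal.ofReal_le_ofReal hω) (le_trans (le_of_eq ?_)
      (ofReal_norm_inner_le_hsNorm e j _))
    rw [_root_.sub_apply, inner_sub_right,
      IsAdmissible.inner_spectralTransform (e.orthonormal.1 j)]

/-- Le Cam's two-point method for the minimax risk. -/
theorem two_point_lower_bound {β L : ℝ} {g₀ g₁ : Space d → ℝ} (h₀ : IsAdmissible β L g₀)
    (h₁ : IsAdmissible β L g₁) (e : HilbertBasis ι ℂ H) (j : ι) {n : ℕ} {δ r : ℝ} {θ₀ : Space d}
    (hsep : 2 * r ≤ ‖scalarTransform g₁ θ₀ - scalarTransform g₀ θ₀‖) {c : ℝ≥0∞}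
    (htest : ∀ B : Set (EuclideanSpace ℝ (Fin d → Fin n)), MeasurableSet B →
      c ≤ multivariateGaussian 0 (gridMatrix n δ g₀) B
        + multivariateGaussian 0 (gridMatrix n δ g₁) Bᶜ) :
    c / 2 ≤ ⨅ T ∈ estimators H d n, ⨆ f ∈ powerLawClass e d β L,
        ⨆ (P : Measure (Space d → H)) (_ : IsStationaryGaussianLaw e P f),
          P {ω | ENNReal.ofReal r ≤ hsNorm e (T (observations n δ ω) θ₀ - f θ₀)} := by
  refine le_iInf₂ fun T hT => ?_
  set R := ⨆ f ∈ powerLawClass e d β L,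
        ⨆ (P : Measure (Space d → H)) (_ : IsStationaryGaussianLaw e P f),
          P {ω | ENNReal.ofReal r ≤ hsNorm e (T (observations n δ ω) θ₀ - f θ₀)}
  have b0 := measure_le_iSup h₀ e j δ r θ₀ hT
  have b1 := measure_le_iSup h₁ e j δ r θ₀ hT
  -- The test rejects the reference when the estimate is at distance at least `r` from its value at
  -- `θ₀`. Otherwise, since the two values are `2 * r` apart, the triangle inequality puts the error
  -- under the alternative above `r`.
  have key := (htest _
    (measurableSet_error_ge hT (e j) θ₀ r (scalarTransform g₀ θ₀))).trans (add_le_add b0 ((measure_mono ?_).trans b1))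
  · rw [ENNReal.div_le_iff (by simp) (by simp), mul_two]
    exact key
  · intro y hy
    simp only [Set.mem_compl_iff, Set.mem_ofPred_eq, not_le] at hy ⊢
    set z := inner ℂ (e j) (T (fun k => ((y k : ℝ) : ℂ) • e j) θ₀ (e j))
    have := norm_sub_le_norm_sub_add_norm_sub (scalarTransform g₁ θ₀) z (scalarTransform g₀ θ₀)
    rw [norm_sub_rev _ z] at this
    linarith

end TwoPoint

end SpectralMinimax

namespace SpectralMinimax

variable {d : ℕ}

/-! ### Integrability of the moment weight -/

section Decay

theorem integrable_exp_neg_half_norm : Integrable fun x : Space d => Real.exp (-‖x‖ / 2) := by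
  have h1 := integrable_one_add_norm (E := Space d) (μ := volume) (r := (d : ℝ) + 1) (by simp)
  refine (h1.const_mul (2 ^ (d + 1) * (d + 1).factorial * Real.exp (1 / 2))).mono'
    (Measurable.aestronglyMeasurable (by fun_prop)) (Eventually.of_forall fun x => ?_)
  rw [Real.norm_of_nonneg (Real.exp_pos _).le]
  have hx : 0 ≤ ‖x‖ := norm_nonneg x
  have h2 := Real.pow_div_factorial_le_exp ((1 + ‖x‖) / 2) (by positivity) (d + 1)
  have h3 : ((1 + ‖x‖) ^ (-((d : ℝ) + 1))) = ((1 + ‖x‖) ^ (d + 1))⁻¹ := by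
    rw [Real.rpow_neg (by positivity)]
    norm_cast
  rw [h3, ← div_eq_mul_inv, le_div_iff₀ (by positivity)]
  rw [div_le_iff₀ (by positivity), div_pow, div_le_iff₀ (by positivity)] at h2
  calc Real.exp (-‖x‖ / 2) * (1 + ‖x‖) ^ (d + 1)
      ≤ Real.exp (-‖x‖ / 2)
        * (Real.exp ((1 + ‖x‖) / 2) * (d + 1).factorial * 2 ^ (d + 1)) := by gcongr
    _ = 2 ^ (d + 1) * (d + 1).factorial
        * (Real.exp (-‖x‖ / 2) * Real.exp ((1 + ‖x‖) / 2)) := by ring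
    _ = _ := by
        rw [← Real.exp_add]
        congr 2
        ring

theorem exists_one_add_rpow_mul_exp_le {β : ℝ} (hβ : 0 < β) :
    ∃ C : ℝ, 0 < C ∧ ∀ t : ℝ, 0 ≤ t → 1 + t ^ β ≤ C * Real.exp (t / 2) := by
  obtain ⟨N, hN⟩ := exists_nat_ge β
  refine ⟨2 + 2 ^ N * N.factorial, by positivity, fun t ht => ?_⟩
  have h1 : t ^ β ≤ 1 + t ^ N := by
    rcases le_total t 1 with h | h
    · exact (Real.rpow_le_one ht h hβ.le).trans (le_add_of_nonneg_right (by positivity))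
    · refine le_trans ?_ (le_add_of_nonneg_left zero_le_one)
      rw [← Real.rpow_natCast]
      exact Real.rpow_le_rpow_of_exponent_le h hN
  have h2 := Real.pow_div_factorial_le_exp (t / 2) (by positivity) N
  rw [div_le_iff₀ (by positivity), div_pow, div_le_iff₀ (by positivity)] at h2
  have h3 : 1 ≤ Real.exp (t / 2) := Real.one_le_exp (by positivity)
  nlinarith

theorem integrable_one_add_rpow_mul_exp_neg {β : ℝ} (hβ : 0 < β) :
    Integrable fun x : Space d => (1 + ‖x‖ ^ β) * Real.exp (-‖x‖) := by
  obtain ⟨C, hC, h⟩ := exists_one_add_rpow_mul_exp_le hβ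
  refine (integrable_exp_neg_half_norm.const_mul C).mono'
    (Measurable.aestronglyMeasurable (by fun_prop)) (Eventually.of_forall fun x => ?_)
  have hx : 0 ≤ ‖x‖ := norm_nonneg x
  rw [Real.norm_of_nonneg (by positivity)]
  calc (1 + ‖x‖ ^ β) * Real.exp (-‖x‖) ≤ C * Real.exp (‖x‖ / 2) * Real.exp (-‖x‖) := by
        gcongr; exact h _ hx
    _ = C * Real.exp (-‖x‖ / 2) := by
        rw [mul_assoc, ← Real.exp_add]
        congr 2
        ring

theorem integrable_one_add_rpow_mul_exp_neg_sq {β : ℝ} (hβ : 0 < β) :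
    Integrable fun x : Space d => (1 + ‖x‖ ^ β) * Real.exp (-‖x‖ ^ 2 / 2) := by
  refine ((integrable_one_add_rpow_mul_exp_neg hβ).const_mul (Real.exp (1 / 2))).mono'
    (Measurable.aestronglyMeasurable (by fun_prop)) (Eventually.of_forall fun x => ?_)
  have hx : 0 ≤ ‖x‖ := norm_nonneg x
  rw [Real.norm_of_nonneg (by positivity)]
  calc (1 + ‖x‖ ^ β) * Real.exp (-‖x‖ ^ 2 / 2)
      ≤ (1 + ‖x‖ ^ β) * Real.exp (1 / 2 + -‖x‖) := by
        gcongr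
        nlinarith [sq_nonneg (‖x‖ - 1)]
    _ = _ := by rw [Real.exp_add]; ring

end Decay

/-! ### Gaussian spectral bumps and their covariances -/

section Bump

open Complex in
theorem integral_cos_add_inner_mul_exp {b : ℝ} (hb : 0 < b) (a : ℝ) (x : Space d) :
    ∫ v : Space d, Real.cos (a + inner ℝ x v) * Real.exp (-b * ‖v‖ ^ 2)
      = (Real.pi / b) ^ ((d : ℝ) / 2) * (Real.cos a * Real.exp (-‖x‖ ^ 2 / (4 * b))) := by
  have hb' : 0 < (b : ℂ).re := hb
  have h1 := GaussianFourier.integral_cexp_neg_mul_sq_norm_add hb' I x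
  have hint := (GaussianFourier.integrable_cexp_neg_mul_sq_norm_add hb' I x).const_mul
    (cexp (a * I))
  have h2 : ∀ v : Space d, Real.cos (a + inner ℝ x v) * Real.exp (-b * ‖v‖ ^ 2)
      = (cexp (a * I) * cexp (-(b : ℂ) * ‖v‖ ^ 2 + I * (inner ℝ x v : ℝ))).re := by
    intro v
    rw [← Complex.exp_add]
    have : (a : ℂ) * I + (-(b : ℂ) * ‖v‖ ^ 2 + I * (inner ℝ x v : ℝ))
        = ((-b * ‖v‖ ^ 2 : ℝ) : ℂ) + ((a + inner ℝ x v : ℝ) : ℂ) * I := by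
      push_cast; ring
    rw [this, Complex.exp_add, ← Complex.ofReal_exp, Complex.re_ofReal_mul,
      Complex.exp_ofReal_mul_I_re]
    ring
  simp_rw [h2]
  have h3 := integral_re hint
  simp only [RCLike.re_to_complex] at h3
  rw [h3, integral_const_mul, h1]
  have h4 : ((Real.pi : ℂ) / b) ^ ((Module.finrank ℝ (Space d) : ℂ) / 2)
      = (((Real.pi / b) ^ ((d : ℝ) / 2) : ℝ) : ℂ) := by
    rw [Complex.ofReal_cpow (by positivity)]
    simp
  have h5 : I ^ 2 * (‖x‖ : ℂ) ^ 2 / (4 * b) = ((-‖x‖ ^ 2 / (4 * b) : ℝ) : ℂ) := by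
    rw [I_sq]; push_cast; ring
  rw [h4, h5, ← Complex.ofReal_exp, ← Complex.ofReal_mul, Complex.re_mul_ofReal,
    Complex.exp_ofReal_mul_I_re]
  ring

theorem integrable_exp_neg_mul_sq_norm {b : ℝ} (hb : 0 < b) :
    Integrable fun v : Space d => Real.exp (-b * ‖v‖ ^ 2) := by
  have h := (GaussianFourier.integrable_cexp_neg_mul_sq_norm_add (b := (b : ℂ)) hb 0
    (0 : Space d)).re
  refine h.congr (Eventually.of_forall fun v => ?_)
  simp only [zero_mul, add_zero, RCLike.re_to_complex]
  rw [show (-(b : ℂ) * (‖v‖ : ℂ) ^ 2) = ((-b * ‖v‖ ^ 2 : ℝ) : ℂ) by push_cast; ring,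
    Complex.exp_ofReal_re]

/-- A spectral bump of width `h` around `θ₀`. -/
noncomputable def bump (θ₀ : Space d) (h : ℝ) (θ : Space d) : ℝ :=
  Real.exp (-(1 / (2 * h ^ 2)) * ‖θ - θ₀‖ ^ 2)

theorem bump_pos (θ₀ : Space d) (h : ℝ) (θ : Space d) : 0 < bump θ₀ h θ := Real.exp_pos _

theorem continuous_bump (θ₀ : Space d) (h : ℝ) : Continuous (bump θ₀ h) := by
  unfold bump; fun_prop

theorem integrable_bump (θ₀ : Space d) {h : ℝ} (hh : 0 < h) : Integrable (bump θ₀ h) :=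
  (integrable_exp_neg_mul_sq_norm (b := 1 / (2 * h ^ 2)) (by positivity)).comp_sub_right θ₀

/-- Ordering of spectral densities passes to covariance matrices; this is why the reference process
contains the bump of width `1`. -/
theorem bump_mono (θ₀ : Space d) {h : ℝ} (hh : 0 < h) (h1 : h ≤ 1) (θ : Space d) :
    bump θ₀ h θ ≤ bump θ₀ 1 θ := by
  unfold bump
  refine Real.exp_le_exp.mpr (mul_le_mul_of_nonneg_right (neg_le_neg ?_) (by positivity))
  refine one_div_le_one_div_of_le (by positivity) ?_
  nlinarith

/-- The covariance function with (unnormalized) spectral measure the symmetrization of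
`w θ dθ`. -/
noncomputable def cosTransform (w : Space d → ℝ) (x : Space d) : ℝ :=
  ∫ θ, Real.cos (inner ℝ x θ) * w θ

theorem integrable_cos_mul {w : Space d → ℝ} (hw : Integrable w) (x : Space d) :
    Integrable fun θ => Real.cos (inner ℝ x θ) * w θ :=
  hw.bdd_mul (c := 1) (Measurable.aestronglyMeasurable (by fun_prop))
    (Eventually.of_forall fun θ => Real.abs_cos_le_one _)

/-- This is the squared modulus of `∑ a k * exp(i ⟨t k, θ⟩)`; its nonnegativity makes every
`cosTransform` of a nonnegative weight a covariance. -/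
theorem sum_mul_cos_inner_sub {κ : Type*} (s : Finset κ) (a : κ → ℝ) (t : κ → Space d)
    (θ : Space d) :
    ∑ k ∈ s, ∑ l ∈ s, a k * a l * Real.cos (inner ℝ (t k - t l) θ)
      = (∑ k ∈ s, a k * Real.cos (inner ℝ (t k) θ)) ^ 2
        + (∑ k ∈ s, a k * Real.sin (inner ℝ (t k) θ)) ^ 2 := by
  rw [sq, sq, Finset.sum_mul_sum, Finset.sum_mul_sum, ← Finset.sum_add_distrib]
  refine Finset.sum_congr rfl fun k _ => ?_
  rw [← Finset.sum_add_distrib]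
  refine Finset.sum_congr rfl fun l _ => ?_
  rw [inner_sub_left, Real.cos_sub]
  ring

theorem sum_mul_cosTransform {w : Space d → ℝ} (hw : Integrable w)
    {κ : Type*} (s : Finset κ) (b : κ → κ → ℝ) (t : κ → Space d) :
    ∑ k ∈ s, ∑ l ∈ s, b k l * cosTransform w (t k - t l)
      = ∫ θ, (∑ k ∈ s, ∑ l ∈ s, b k l * Real.cos (inner ℝ (t k - t l) θ)) * w θ := by
  have hi : ∀ k l, Integrable fun θ => b k l * Real.cos (inner ℝ (t k - t l) θ) * w θ := by
    intro k l
    simp_rw [mul_assoc]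
    exact (integrable_cos_mul hw _).const_mul _
  simp_rw [Finset.sum_mul]
  rw [integral_finsetSum _ fun k _ => integrable_finsetSum _ fun l _ => hi k l]
  refine Finset.sum_congr rfl fun k _ => ?_
  rw [integral_finsetSum _ fun l _ => hi k l]
  refine Finset.sum_congr rfl fun l _ => ?_
  unfold cosTransform
  rw [← integral_const_mul]
  simp_rw [mul_assoc]

theorem sum_mul_cosTransform_nonneg {w : Space d → ℝ} (hw : Integrable w) (hw0 : ∀ θ, 0 ≤ w θ)
    {κ : Type*} (s : Finset κ) (a : κ → ℝ) (t : κ → Space d) :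
    0 ≤ ∑ k ∈ s, ∑ l ∈ s, a k * a l * cosTransform w (t k - t l) := by
  rw [sum_mul_cosTransform hw s (fun k l => a k * a l) t]
  refine integral_nonneg fun θ => mul_nonneg ?_ (hw0 θ)
  rw [sum_mul_cos_inner_sub]
  positivity

theorem cosTransform_neg (w : Space d → ℝ) (x : Space d) :
    cosTransform w (-x) = cosTransform w x := by
  simp [cosTransform, inner_neg_left]

theorem cosTransform_bump (θ₀ : Space d) {h : ℝ} (hh : 0 < h) (x : Space d) :
    cosTransform (bump θ₀ h) x = (2 * Real.pi) ^ ((d : ℝ) / 2) * h ^ d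
      * (Real.cos (inner ℝ x θ₀) * Real.exp (-(h ^ 2 / 2) * ‖x‖ ^ 2)) := by
  unfold cosTransform
  rw [← integral_add_right_eq_self _ θ₀]
  simp only [bump, add_sub_cancel_right, inner_add_right]
  simp_rw [add_comm (inner ℝ x _ : ℝ) (inner ℝ x θ₀)]
  rw [integral_cos_add_inner_mul_exp (by positivity)]
  have h1 : Real.pi / (1 / (2 * h ^ 2)) = 2 * Real.pi * h ^ 2 := by field_simp
  have h2 : -‖x‖ ^ 2 / (4 * (1 / (2 * h ^ 2))) = -(h ^ 2 / 2) * ‖x‖ ^ 2 := by field_simp; ring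
  rw [h1, h2, Real.mul_rpow (by positivity) (by positivity)]
  congr 2
  rw [← Real.rpow_natCast h 2, ← Real.rpow_mul hh.le, ← Real.rpow_natCast h d]
  congr 1
  push_cast
  ring

/-- From `‖θ‖² ≤ 2‖θ₀‖² + 2‖θ - θ₀‖²` and `h ≤ 1`, the growing factor costs `exp(‖θ₀‖² / 4)` and at
most half of the Gaussian exponent. What remains is a bump of comparable width, with integral of
order `h ^ d`. -/
theorem integral_exp_mul_bump_le (θ₀ : Space d) {h : ℝ} (hh : 0 < h) (h1 : h ≤ 1) :
    Integrable (fun θ => Real.exp (‖θ‖ ^ 2 / 8) * bump θ₀ h θ) ∧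
    ∫ θ, Real.exp (‖θ‖ ^ 2 / 8) * bump θ₀ h θ
      ≤ Real.exp (‖θ₀‖ ^ 2 / 4) * (4 * Real.pi) ^ ((d : ℝ) / 2) * h ^ d := by
  have hb : 0 < 1 / (4 * h ^ 2) := by positivity
  have hint : Integrable fun θ : Space d =>
      Real.exp (‖θ₀‖ ^ 2 / 4) * Real.exp (-(1 / (4 * h ^ 2)) * ‖θ - θ₀‖ ^ 2) :=
    ((integrable_exp_neg_mul_sq_norm hb).comp_sub_right θ₀).const_mul _
  have hle : ∀ θ : Space d, Real.exp (‖θ‖ ^ 2 / 8) * bump θ₀ h θ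
      ≤ Real.exp (‖θ₀‖ ^ 2 / 4) * Real.exp (-(1 / (4 * h ^ 2)) * ‖θ - θ₀‖ ^ 2) := by
    intro θ
    unfold bump
    rw [← Real.exp_add, ← Real.exp_add]
    refine Real.exp_le_exp.mpr ?_
    have h2 : ‖θ‖ ^ 2 ≤ 2 * ‖θ₀‖ ^ 2 + 2 * ‖θ - θ₀‖ ^ 2 := by
      have h3 := norm_add_le θ₀ (θ - θ₀)
      rw [add_sub_cancel] at h3
      nlinarith [norm_nonneg θ, sq_nonneg (‖θ₀‖ - ‖θ - θ₀‖)]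
    have h4 : 1 ≤ 1 / h ^ 2 := by
      rw [le_div_iff₀ (by positivity)]; nlinarith
    have h5 : 1 / (2 * h ^ 2) = 1 / 2 * (1 / h ^ 2) := by field_simp
    have h6 : 1 / (4 * h ^ 2) = 1 / 4 * (1 / h ^ 2) := by field_simp
    rw [h5, h6]
    nlinarith [mul_le_mul_of_nonneg_right h4 (sq_nonneg ‖θ - θ₀‖)]
  have hpos : ∀ θ : Space d, 0 ≤ Real.exp (‖θ‖ ^ 2 / 8) * bump θ₀ h θ := fun θ =>
    mul_nonneg (Real.exp_pos _).le (bump_pos _ _ _).le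
  have hint' : Integrable (fun θ => Real.exp (‖θ‖ ^ 2 / 8) * bump θ₀ h θ) := by
    refine hint.mono' (Measurable.aestronglyMeasurable ?_) (Eventually.of_forall fun θ => ?_)
    · exact Measurable.mul (by fun_prop) (continuous_bump _ _).measurable
    · rw [Real.norm_of_nonneg (hpos θ)]; exact hle θ
  refine ⟨hint', (integral_mono hint' hint hle).trans_eq ?_⟩
  rw [integral_const_mul, integral_sub_right_eq_self
    (fun θ : Space d => Real.exp (-(1 / (4 * h ^ 2)) * ‖θ‖ ^ 2)) θ₀]
  rw [GaussianFourier.integral_rexp_neg_mul_sq_norm hb, mul_assoc]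
  have h1 : Real.pi / (1 / (4 * h ^ 2)) = 4 * Real.pi * h ^ 2 := by field_simp
  rw [h1, finrank_euclideanSpace_fin, Real.mul_rpow (by positivity) (by positivity)]
  congr 2
  rw [← Real.rpow_natCast h 2, ← Real.rpow_mul hh.le, ← Real.rpow_natCast h d]
  congr 1
  push_cast
  ring

theorem integrable_cosTransform_bump (θ₀ : Space d) {h : ℝ} (hh : 0 < h) :
    Integrable (cosTransform (bump θ₀ h)) := by
  have h1 : cosTransform (bump θ₀ h) = fun x => (2 * Real.pi) ^ ((d : ℝ) / 2) * h ^ d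
      * (Real.cos (inner ℝ x θ₀) * Real.exp (-(h ^ 2 / 2) * ‖x‖ ^ 2)) :=
    funext fun x => cosTransform_bump θ₀ hh x
  rw [h1]
  refine Integrable.const_mul ?_ _
  exact (integrable_exp_neg_mul_sq_norm (by positivity)).bdd_mul (c := 1)
    (Measurable.aestronglyMeasurable (by fun_prop))
    (Eventually.of_forall fun θ => Real.abs_cos_le_one _)

theorem scalarTransform_re {g : Space d → ℝ} (hg : Integrable g) (θ : Space d) :
    (scalarTransform g θ).re
      = ((2 * Real.pi) ^ d)⁻¹ * ∫ x, Real.cos (inner ℝ x θ) * g x := by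
  unfold scalarTransform
  have hint : Integrable fun x : Space d =>
      Complex.exp (Complex.I * ((inner ℝ x θ : ℝ) : ℂ)) * (g x : ℂ) := by
    refine hg.ofReal.bdd_mul (c := 1) (Measurable.aestronglyMeasurable (by fun_prop))
      (Eventually.of_forall fun x => ?_)
    rw [mul_comm, Complex.norm_exp_ofReal_mul_I]
  rw [Complex.re_ofReal_mul]
  have h3 := integral_re hint
  simp only [RCLike.re_to_complex] at h3
  rw [← h3]
  congr 2
  ext x
  rw [Complex.re_mul_ofReal, mul_comm Complex.I, Complex.exp_ofReal_mul_I_re]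

/-- The value at `θ₀` of the transform of the bump covariance is at least `1 / 2`. -/
theorem half_le_scalarTransform_cosTransform_bump (θ₀ : Space d) {h : ℝ} (hh : 0 < h) :
    1 / 2 ≤ (scalarTransform (cosTransform (bump θ₀ h)) θ₀).re := by
  rw [scalarTransform_re (integrable_cosTransform_bump θ₀ hh)]
  have hb : 0 < h ^ 2 / 2 := by positivity
  -- A real covariance has an even spectral density, so the bump appears with weight `1 / 2` at `θ₀`
  -- and at `-θ₀`. Writing `2 cos² = 1 + cos 2·` separates the two: the first gives `1 / 2`, the
  -- mirror image a nonnegative term `E / 2`.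
  have h1 : ∀ x : Space d, Real.cos (inner ℝ x θ₀) * cosTransform (bump θ₀ h) x
      = (2 * Real.pi) ^ ((d : ℝ) / 2) * h ^ d / 2
        * (Real.exp (-(h ^ 2 / 2) * ‖x‖ ^ 2)
          + Real.cos (0 + inner ℝ ((2 : ℝ) • θ₀) x) * Real.exp (-(h ^ 2 / 2) * ‖x‖ ^ 2)) := by
    intro x
    rw [cosTransform_bump θ₀ hh, zero_add, real_inner_smul_left, real_inner_comm, Real.cos_two_mul]
    ring
  simp_rw [h1]
  have hint := integrable_exp_neg_mul_sq_norm (d := d) hb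
  rw [integral_const_mul, integral_add hint
    (hint.bdd_mul (c := 1) (Measurable.aestronglyMeasurable (by fun_prop))
      (Eventually.of_forall fun θ => Real.abs_cos_le_one _)),
    integral_cos_add_inner_mul_exp hb, GaussianFourier.integral_rexp_neg_mul_sq_norm hb,
    finrank_euclideanSpace_fin, Real.cos_zero, one_mul]
  have h2 : (Real.pi / (h ^ 2 / 2)) ^ ((d : ℝ) / 2) = (2 * Real.pi) ^ ((d : ℝ) / 2) / h ^ d := by
    have : Real.pi / (h ^ 2 / 2) = 2 * Real.pi / h ^ 2 := by field_simp
    rw [this, Real.div_rpow (by positivity) (by positivity)]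
    congr 1
    rw [← Real.rpow_natCast h 2, ← Real.rpow_mul hh.le, ← Real.rpow_natCast h d]
    congr 1
    push_cast
    ring
  have h3 : (2 * Real.pi) ^ ((d : ℝ) / 2) * (2 * Real.pi) ^ ((d : ℝ) / 2) = (2 * Real.pi) ^ d := by
    rw [← Real.rpow_add (by positivity), add_halves, Real.rpow_natCast]
  rw [h2]
  have h4 : 0 ≤ Real.exp (-‖(2 : ℝ) • θ₀‖ ^ 2 / (4 * (h ^ 2 / 2))) := (Real.exp_pos _).le
  generalize Real.exp (-‖(2 : ℝ) • θ₀‖ ^ 2 / (4 * (h ^ 2 / 2))) = E at h4 ⊢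
  have h5 : ((2 * Real.pi) ^ d)⁻¹ * ((2 * Real.pi) ^ ((d : ℝ) / 2) * h ^ d / 2
      * ((2 * Real.pi) ^ ((d : ℝ) / 2) / h ^ d + (2 * Real.pi) ^ ((d : ℝ) / 2) / h ^ d * E))
      = (1 + E) / 2 := by
    rw [← h3]
    have : (2 * Real.pi) ^ ((d : ℝ) / 2) ≠ 0 := by positivity
    field_simp
  rw [h5]
  linarith

end Bump

/-! ### Membership in the power-law class -/

section Admissible

variable {β L L' : ℝ} {g g' : Space d → ℝ}

theorem IsAdmissible.add (hg : IsAdmissible β L g) (hg' : IsAdmissible β L' g') (hL : 0 ≤ L)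
    (hL' : 0 ≤ L') : IsAdmissible β (L + L') fun x => g x + g' x where
  symm x := by rw [hg.symm, hg'.symm]
  nonneg I a := by
    simp_rw [mul_add, Finset.sum_add_distrib]
    exact add_nonneg (hg.nonneg I a) (hg'.nonneg I a)
  continuous := hg.continuous.add hg'.continuous
  lintegral_le := by
    rw [ENNReal.ofReal_add hL hL']
    refine le_trans ?_ (add_le_add hg.lintegral_le hg'.lintegral_le)
    have hm : Measurable fun x => ENNReal.ofReal (1 + ‖x‖ ^ β) * ENNReal.ofReal |g x| := by
      have := hg.continuous.measurable
      fun_prop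
    rw [← lintegral_add_left hm]
    refine lintegral_mono fun x => ?_
    rw [← mul_add, ← ENNReal.ofReal_add (abs_nonneg _) (abs_nonneg _)]
    gcongr
    exact abs_add_le _ _

theorem IsAdmissible.mono (hg : IsAdmissible β L g) (h : L ≤ L') : IsAdmissible β L' g :=
  ⟨hg.symm, hg.nonneg, hg.continuous, hg.lintegral_le.trans (ENNReal.ofReal_le_ofReal h)⟩

theorem IsAdmissible.integrable (hg : IsAdmissible β L g) : Integrable g := by
  refine ⟨hg.continuous.aestronglyMeasurable, ?_⟩
  rw [hasFiniteIntegral_iff_norm]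
  exact hg.lintegral_lt_top

theorem lintegral_weight_le {F : Space d → ℝ} (hF : Integrable F)
    (h : ∀ x, (1 + ‖x‖ ^ β) * |g x| ≤ F x) :
    ∫⁻ x, ENNReal.ofReal (1 + ‖x‖ ^ β) * ENNReal.ofReal |g x| ≤ ENNReal.ofReal (∫ x, F x) := by
  have hw : ∀ x : Space d, 0 ≤ 1 + ‖x‖ ^ β := fun x =>
    add_nonneg zero_le_one (Real.rpow_nonneg (norm_nonneg _) _)
  rw [ofReal_integral_eq_lintegral_ofReal hF (Eventually.of_forall fun x =>
    (mul_nonneg (hw x) (abs_nonneg _)).trans (h x))]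
  refine lintegral_mono fun x => ?_
  rw [← ENNReal.ofReal_mul (hw x)]
  exact ENNReal.ofReal_le_ofReal (h x)

/-- Substituting `h • x` absorbs the factor `h ^ d`, and `(1 + ‖x‖ ^ β) * h ^ β ≤ 1 + ‖h • x‖ ^ β`
for `h ≤ 1`. The amplitude `h ^ β` therefore gives a bound independent of `h`. -/
theorem isAdmissible_bump (hβ : 0 < β) (θ₀ : Space d) {a h : ℝ} (ha : 0 ≤ a) (hh : 0 < h)
    (h1 : h ≤ 1) :
    IsAdmissible β (a * ((2 * Real.pi) ^ ((d : ℝ) / 2)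
        * ∫ x : Space d, (1 + ‖x‖ ^ β) * Real.exp (-‖x‖ ^ 2 / 2)))
      fun x => a * h ^ β * cosTransform (bump θ₀ h) x where
  symm x := by rw [cosTransform_neg]
  nonneg I b := by
    have h2 := sum_mul_cosTransform_nonneg (integrable_bump θ₀ hh)
      (fun θ => (bump_pos θ₀ h θ).le) I b id
    have h3 : ∑ s ∈ I, ∑ t ∈ I, b s * b t * (a * h ^ β * cosTransform (bump θ₀ h) (s - t))
        = a * h ^ β * ∑ s ∈ I, ∑ t ∈ I, b s * b t * cosTransform (bump θ₀ h) (id s - id t) := by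
      simp_rw [Finset.mul_sum]
      exact Finset.sum_congr rfl fun s _ => Finset.sum_congr rfl fun t _ => by simp only [id]; ring
    rw [h3]
    positivity
  continuous := by
    have h2 : cosTransform (bump θ₀ h) = fun x => (2 * Real.pi) ^ ((d : ℝ) / 2) * h ^ d
        * (Real.cos (inner ℝ x θ₀) * Real.exp (-(h ^ 2 / 2) * ‖x‖ ^ 2)) :=
      funext fun x => cosTransform_bump θ₀ hh x
    rw [h2]
    fun_prop
  lintegral_le := by
    set F : Space d → ℝ := fun x => (1 + ‖x‖ ^ β) * Real.exp (-‖x‖ ^ 2 / 2) with hF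
    have hFint : Integrable F := integrable_one_add_rpow_mul_exp_neg_sq hβ
    have hG : Integrable fun x : Space d =>
        a * ((2 * Real.pi) ^ ((d : ℝ) / 2) * (h ^ d * F (h • x))) :=
      (((hFint.comp_smul hh.ne').const_mul _).const_mul _).const_mul _
    have h2 : ∫ x : Space d, a * ((2 * Real.pi) ^ ((d : ℝ) / 2) * (h ^ d * F (h • x)))
        = a * ((2 * Real.pi) ^ ((d : ℝ) / 2) * ∫ x, F x) := by
      rw [integral_const_mul, integral_const_mul, integral_const_mul, Measure.integral_comp_smul,
        finrank_euclideanSpace_fin, smul_eq_mul, abs_of_pos (by positivity), ← mul_assoc (h ^ d),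
        mul_inv_cancel₀ (by positivity), one_mul]
    rw [← h2]
    refine lintegral_weight_le hG fun x => ?_
    rw [cosTransform_bump θ₀ hh, abs_mul (a * h ^ β), abs_mul _ (Real.cos _ * _), abs_mul (Real.cos _),
      abs_of_nonneg (show 0 ≤ a * h ^ β by positivity),
      abs_of_pos (show 0 < (2 * Real.pi) ^ ((d : ℝ) / 2) * h ^ d by positivity),
      abs_of_pos (Real.exp_pos _)]
    simp only [hF, norm_smul, Real.norm_of_nonneg hh.le]
    have h3 : -(h * ‖x‖) ^ 2 / 2 = -(h ^ 2 / 2) * ‖x‖ ^ 2 := by ring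
    rw [h3, Real.mul_rpow hh.le (norm_nonneg _)]
    have h4 : (1 + ‖x‖ ^ β) * h ^ β ≤ 1 + h ^ β * ‖x‖ ^ β := by
      have := Real.rpow_le_one hh.le h1 hβ.le
      linarith
    calc (1 + ‖x‖ ^ β) * (a * h ^ β * ((2 * Real.pi) ^ ((d : ℝ) / 2) * h ^ d
          * (|Real.cos (inner ℝ x θ₀)| * Real.exp (-(h ^ 2 / 2) * ‖x‖ ^ 2))))
        ≤ (1 + ‖x‖ ^ β) * (a * h ^ β * ((2 * Real.pi) ^ ((d : ℝ) / 2) * h ^ d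
          * (1 * Real.exp (-(h ^ 2 / 2) * ‖x‖ ^ 2)))) := by
          gcongr
          exact Real.abs_cos_le_one _
      _ = ((1 + ‖x‖ ^ β) * h ^ β) * (a * ((2 * Real.pi) ^ ((d : ℝ) / 2) * h ^ d
          * Real.exp (-(h ^ 2 / 2) * ‖x‖ ^ 2))) := by ring
      _ ≤ (1 + h ^ β * ‖x‖ ^ β) * (a * ((2 * Real.pi) ^ ((d : ℝ) / 2) * h ^ d
          * Real.exp (-(h ^ 2 / 2) * ‖x‖ ^ 2))) := by gcongr
      _ = _ := by ring

/-- The product of `d` Ornstein-Uhlenbeck covariance functions. -/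
noncomputable def expKernel (x : Space d) : ℝ := Real.exp (-∑ i, |x i|)

theorem exp_two_mul_eq_measure_Iic (x : ℝ) :
    ((volume.withDensity fun u => ENNReal.ofReal (2 * Real.exp (2 * u))) (Set.Iic x))
      = ENNReal.ofReal (Real.exp (2 * x)) := by
  rw [withDensity_apply _ measurableSet_Iic, ← ofReal_integral_eq_lintegral_ofReal]
  · rw [integral_const_mul, integral_exp_mul_Iic (by norm_num)]
    congr 1
    ring
  · exact (integrableOn_exp_mul_Iic (by norm_num) x).const_mul 2
  · exact Eventually.of_forall fun u => by positivity

/-- Coordinatewise `-|s - t| = 2 * min s t - s - t`, and `exp (2 * min s t)` is the measure of `Iic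
s ∩ Iic t` for the density `2 * exp (2 * u)`. The kernel is thus a rescaled Gram matrix of indicator
functions. -/
theorem sum_mul_expKernel_nonneg (I : Finset (Space d)) (a : Space d → ℝ) :
    0 ≤ ∑ s ∈ I, ∑ t ∈ I, a s * a t * expKernel (s - t) := by
  let ν : Measure ℝ := volume.withDensity fun u => ENNReal.ofReal (2 * Real.exp (2 * u))
  have hν : SigmaFinite ν := SigmaFinite.withDensity_ofReal _
  let μ : Measure (Fin d → ℝ) := Measure.pi fun _ => ν
  have hμ : ∀ x : Fin d → ℝ, μ (Set.Iic x) = ENNReal.ofReal (Real.exp (∑ i, 2 * x i)) := by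
    intro x
    rw [← Set.pi_univ_Iic, Measure.pi_pi, Real.exp_sum,
      ENNReal.ofReal_prod_of_nonneg fun i _ => (Real.exp_pos _).le]
    exact Finset.prod_congr rfl fun i _ => exp_two_mul_eq_measure_Iic (x i)
  have hpsd := posSemidef_matrix_measure_inter (μ := μ) (s := fun s : I => Set.Iic (s : Space d).ofLp)
    (fun _ => measurableSet_Iic) fun s => by rw [hμ]; exact ENNReal.ofReal_ne_top
  have h1 := hpsd.dotProduct_mulVec_nonneg fun s : I => a s * Real.exp (-∑ i, (s : Space d) i)
  have h2 : ∀ s t : Space d, expKernel (s - t) = Real.exp (-∑ i, s i) * Real.exp (-∑ i, t i)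
      * μ.real (Set.Iic s.ofLp ∩ Set.Iic t.ofLp) := by
    intro s t
    rw [Set.Iic_inter_Iic, measureReal_def, hμ, ENNReal.toReal_ofReal (Real.exp_pos _).le,
      ← Real.exp_add, ← Real.exp_add, expKernel]
    congr 1
    simp only [← Finset.sum_neg_distrib, ← Finset.sum_add_distrib]
    refine Finset.sum_congr rfl fun i _ => ?_
    simp only [PiLp.sub_apply, Pi.inf_apply]
    rcases le_total (s i) (t i) with h | h
    · rw [inf_eq_left.mpr h, abs_of_nonpos (by linarith)]; ring
    · rw [inf_eq_right.mpr h, abs_of_nonneg (by linarith)]; ring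
  refine h1.trans_eq ?_
  simp only [dotProduct, Matrix.mulVec, Pi.star_apply, star_trivial, Matrix.of_apply,
    Finset.mul_sum]
  rw [← Finset.sum_coe_sort I]
  refine Finset.sum_congr rfl fun s _ => ?_
  rw [← Finset.sum_coe_sort I]
  refine Finset.sum_congr rfl fun t _ => ?_
  rw [h2]
  ring

theorem isAdmissible_expKernel (hβ : 0 < β) {c : ℝ} (hc : 0 ≤ c) :
    IsAdmissible β (c * ∫ x : Space d, (1 + ‖x‖ ^ β) * Real.exp (-‖x‖))
      fun x : Space d => c * expKernel x where
  symm x := by simp [expKernel]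
  nonneg I b := by
    have h2 := sum_mul_expKernel_nonneg I b
    have h3 : ∑ s ∈ I, ∑ t ∈ I, b s * b t * (c * expKernel (s - t))
        = c * ∑ s ∈ I, ∑ t ∈ I, b s * b t * expKernel (s - t) := by
      simp_rw [Finset.mul_sum]
      exact Finset.sum_congr rfl fun s _ => Finset.sum_congr rfl fun t _ => by ring
    rw [h3]
    positivity
  continuous := by unfold expKernel; fun_prop
  lintegral_le := by
    rw [← integral_const_mul]
    refine lintegral_weight_le ((integrable_one_add_rpow_mul_exp_neg hβ).const_mul c) fun x => ?_
    unfold expKernel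
    rw [abs_mul, abs_of_nonneg hc, abs_of_pos (Real.exp_pos _)]
    have h1 : ‖x‖ ≤ ∑ i, |x i| := by
      rw [EuclideanSpace.norm_eq]
      refine Real.sqrt_le_iff.mpr ⟨Finset.sum_nonneg fun i _ => abs_nonneg _, ?_⟩
      simp only [Real.norm_eq_abs]
      exact Finset.sum_sq_le_sq_sum_of_nonneg fun i _ => abs_nonneg _
    calc (1 + ‖x‖ ^ β) * (c * Real.exp (-∑ i, |x i|))
        ≤ (1 + ‖x‖ ^ β) * (c * Real.exp (-‖x‖)) := by gcongr
      _ = _ := by ring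

end Admissible

end SpectralMinimax

namespace SpectralMinimax

/-! ### Whitening of a one-dimensional Ornstein–Uhlenbeck sample -/

section Autoregression

/-- The innovation standard deviations of the stationary autoregression. -/
noncomputable def innovation (ρ : ℝ) (l : ℕ) : ℝ := if l = 0 then 1 else √(1 - ρ ^ 2)

/-- The Cholesky factor of the covariance matrix of the stationary autoregression. -/
noncomputable def arFactor (ρ : ℝ) (k l : ℕ) : ℝ :=
  if l ≤ k then ρ ^ (k - l) * innovation ρ l else 0

theorem sum_arFactor_zero (ρ : ℝ) {n : ℕ} (hn : 0 < n) (x : ℕ → ℂ) :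
    ∑ l ∈ Finset.range n, (arFactor ρ 0 l : ℂ) * x l = x 0 := by
  rw [Finset.sum_eq_single 0]
  · simp [arFactor, innovation]
  · intro l _ hl
    simp [arFactor, hl]
  · simp [hn.ne']

/-- This is the recursion `X (k + 1) = ρ * X k + √(1 - ρ²) * ε (k + 1)`, from which the covariance
and the inverse of the factor are both derived by induction. -/
theorem sum_arFactor_succ (ρ : ℝ) {n k : ℕ} (hk : k + 1 < n) (x : ℕ → ℂ) :
    ∑ l ∈ Finset.range n, (arFactor ρ (k + 1) l : ℂ) * x l
      = ρ * ∑ l ∈ Finset.range n, (arFactor ρ k l : ℂ) * x l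
        + (innovation ρ (k + 1) : ℂ) * x (k + 1) := by
  have h1 : ∀ l ∈ Finset.range n, (arFactor ρ (k + 1) l : ℂ) * x l
      = ρ * ((arFactor ρ k l : ℂ) * x l)
        + if l = k + 1 then (innovation ρ (k + 1) : ℂ) * x (k + 1) else 0 := by
    intro l _
    unfold arFactor
    rcases lt_trichotomy l (k + 1) with h | h | h
    · rw [if_pos h.le, if_pos (by omega), if_neg h.ne, Nat.succ_sub (by omega), pow_succ]
      push_cast
      ring
    · subst h
      simp
    · rw [if_neg (by omega), if_neg (by omega), if_neg (by omega)]
      simp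
  rw [Finset.sum_congr rfl h1, Finset.sum_add_distrib, ← Finset.mul_sum, Finset.sum_ite_eq',
    if_pos (Finset.mem_range.mpr hk)]

theorem sum_arFactor_mul {ρ : ℝ} (hρ : ρ ^ 2 ≤ 1) {n k k' : ℕ} (hk : k ≤ k') (hk' : k' < n) :
    ∑ l ∈ Finset.range n, arFactor ρ k l * arFactor ρ k' l = ρ ^ (k' - k) := by
  have key : ∀ k, k ≤ k' → ∑ l ∈ Finset.range n, (arFactor ρ k l : ℂ) * (arFactor ρ k' l : ℂ)
      = (ρ : ℂ) ^ (k' - k) := by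
    intro k
    induction k with
    | zero =>
      intro _
      rw [sum_arFactor_zero ρ (by omega) fun l => (arFactor ρ k' l : ℂ)]
      simp [arFactor, innovation]
    | succ k ih =>
      intro h
      rw [sum_arFactor_succ ρ (by omega) fun l => (arFactor ρ k' l : ℂ), ih (by omega)]
      simp only [arFactor, innovation, if_pos h]
      obtain ⟨m, rfl⟩ := Nat.exists_eq_add_of_le h
      have e1 : k + 1 + m - k = m + 1 := by omega
      have e2 : k + 1 + m - (k + 1) = m := by omega
      rw [e1, e2, if_neg (by omega)]
      have hs : ((√(1 - ρ ^ 2) : ℝ) : ℂ) * ((√(1 - ρ ^ 2) : ℝ) : ℂ) = 1 - (ρ : ℂ) ^ 2 := by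
        rw [← Complex.ofReal_mul, Real.mul_self_sqrt (by linarith)]
        push_cast; ring
      push_cast
      linear_combination (ρ : ℂ) ^ m * hs
  exact_mod_cast key k hk

/-- The innovations of the deterministic sequence `v`. -/
noncomputable def whiten (ρ : ℝ) (v : ℕ → ℂ) (l : ℕ) : ℂ :=
  match l with
  | 0 => v 0
  | l + 1 => (v (l + 1) - ρ * v l) / √(1 - ρ ^ 2)

theorem sum_arFactor_whiten {ρ : ℝ} (hρ : ρ ^ 2 < 1) (v : ℕ → ℂ) {n k : ℕ} (hk : k < n) :
    ∑ l ∈ Finset.range n, (arFactor ρ k l : ℂ) * whiten ρ v l = v k := by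
  induction k with
  | zero => rw [sum_arFactor_zero ρ hk]; rfl
  | succ k ih =>
    rw [sum_arFactor_succ ρ hk, ih (by omega)]
    have h : ((√(1 - ρ ^ 2) : ℝ) : ℂ) ≠ 0 := by
      exact_mod_cast (Real.sqrt_pos.mpr (by linarith)).ne'
    simp only [innovation, whiten]
    rw [if_neg (by omega)]
    field_simp
    ring

theorem exp_neg_sq_lt_one {δ : ℝ} (hδ : 0 < δ) : Real.exp (-δ) ^ 2 < 1 := by
  rw [← Real.exp_nat_mul]
  exact Real.exp_lt_one_iff.mpr (by push_cast; linarith)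

/-- The numerator is `(1 - ρ)² + 2ρ(1 - cos(δθ))` with `ρ = exp(-δ)`. The inequalities `ρ * δ ≤ 1 -
ρ ≤ δ` hold for every `δ > 0`, so one innovation of the exponential sequence carries energy `O(δ)`
rather than `O(1)`. Hence `n * δ`, not `n`, is the effective sample size. -/
theorem norm_exp_sub_sq_le {δ : ℝ} (hδ : 0 < δ) (θ : ℝ) :
    ((Real.cos (δ * θ) - Real.exp (-δ)) ^ 2 + Real.sin (δ * θ) ^ 2)
        / (1 - Real.exp (-δ) ^ 2) ≤ δ * (1 + θ ^ 2) := by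
  set ρ := Real.exp (-δ) with hρ
  have h0 : 0 < ρ := Real.exp_pos _
  have h1 : ρ < 1 := by rw [hρ]; exact Real.exp_lt_one_iff.mpr (by linarith)
  have h2 : 1 - ρ ≤ δ := by have := Real.add_one_le_exp (-δ); linarith
  have h3 : ρ * δ ≤ 1 - ρ := by
    have h4 := Real.add_one_le_exp δ
    have h5 : ρ * Real.exp δ = 1 := by rw [hρ, ← Real.exp_add]; simp
    nlinarith
  have hc := Real.one_sub_sq_div_two_le_cos (x := δ * θ)
  have hsc := Real.sin_sq_add_cos_sq (δ * θ)
  rw [div_le_iff₀ (by nlinarith)]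
  have h6 : (Real.cos (δ * θ) - ρ) ^ 2 + Real.sin (δ * θ) ^ 2
      ≤ (1 - ρ) ^ 2 + ρ * δ * (δ * θ ^ 2) := by nlinarith
  have h7 : ρ * δ * (δ * θ ^ 2) ≤ (1 - ρ) * (δ * θ ^ 2) :=
    mul_le_mul_of_nonneg_right h3 (by positivity)
  have h8 : (1 - ρ) ^ 2 ≤ (1 - ρ) * δ := by nlinarith
  have h9 : (1 - ρ) * (δ * (1 + θ ^ 2)) ≤ (1 - ρ ^ 2) * (δ * (1 + θ ^ 2)) :=
    mul_le_mul_of_nonneg_right (by nlinarith) (by positivity)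
  nlinarith

theorem sum_norm_whiten_sq_le {δ : ℝ} (hδ : 0 < δ) (θ : ℝ) {n : ℕ} (hn : 1 ≤ n * δ) :
    ∑ l ∈ Finset.range n, ‖whiten (Real.exp (-δ))
        (fun k => Complex.exp (((δ * (k + 1) * θ : ℝ) : ℂ) * Complex.I)) l‖ ^ 2
      ≤ 16 * (n * δ) * Real.exp (θ ^ 2 / 8) := by
  set v : ℕ → ℂ := fun k => Complex.exp (((δ * (k + 1) * θ : ℝ) : ℂ) * Complex.I) with hv
  have h1 : ∀ l, ‖whiten (Real.exp (-δ)) v (l + 1)‖ ^ 2 ≤ δ * (1 + θ ^ 2) := by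
    intro l
    refine le_trans (le_of_eq ?_) (norm_exp_sub_sq_le hδ θ)
    have h0 : 0 ≤ 1 - Real.exp (-δ) ^ 2 := by
      have : Real.exp (-δ) ≤ 1 := Real.exp_le_one_iff.mpr (by linarith)
      nlinarith [Real.exp_pos (-δ)]
    have h2 : v (l + 1) - (Real.exp (-δ) : ℂ) * v l
        = v l * (((Real.cos (δ * θ) - Real.exp (-δ) : ℝ) : ℂ)
          + ((Real.sin (δ * θ) : ℝ) : ℂ) * Complex.I) := by
      have h3 : v (l + 1) = v l * Complex.exp (((δ * θ : ℝ) : ℂ) * Complex.I) := by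
        simp only [hv]
        rw [← Complex.exp_add]
        congr 1
        push_cast
        ring
      rw [h3, Complex.exp_mul_I]
      push_cast
      ring
    simp only [whiten]
    rw [norm_div, h2, norm_mul, div_pow, mul_pow, ← Complex.normSq_eq_norm_sq (_ + _),
      Complex.normSq_add_mul_I, Complex.norm_of_nonneg (Real.sqrt_nonneg _), Real.sq_sqrt h0]
    simp only [hv, Complex.norm_exp_ofReal_mul_I, one_pow, one_mul]
  -- The first term is not a difference and contributes `1`, which `1 ≤ n * δ` absorbs.
  have h2 : ∀ l, ‖whiten (Real.exp (-δ)) v l‖ ^ 2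
      ≤ (if l = 0 then 1 else 0) + δ * (1 + θ ^ 2) := by
    intro l
    cases l with
    | zero =>
      simp only [whiten, hv, Complex.norm_exp_ofReal_mul_I]
      simp only [one_pow, if_pos]
      exact le_add_of_nonneg_right (by positivity)
    | succ l => simpa using h1 l
  refine (Finset.sum_le_sum fun l _ => h2 l).trans ?_
  rw [Finset.sum_add_distrib, Finset.sum_ite_eq' , Finset.sum_const, Finset.card_range,
    nsmul_eq_mul]
  have h3 : (if 0 ∈ Finset.range n then (1 : ℝ) else 0) ≤ n * δ := by
    split_ifs <;> linarith
  -- The polynomial `2 + θ²` is replaced by `16 * exp(θ² / 8)` because exponentials multiply across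
  -- coordinates into `exp(‖θ‖² / 8)`, which remains integrable against bumps of width at most `1`.
  have h4 := Real.add_one_le_exp (θ ^ 2 / 8)
  have h5 : 0 ≤ n * δ := by linarith
  calc _ ≤ n * δ + n * (δ * (1 + θ ^ 2)) := by gcongr
    _ = (n * δ) * (2 + θ ^ 2) := by ring
    _ ≤ (n * δ) * (16 * Real.exp (θ ^ 2 / 8)) := by gcongr; nlinarith [sq_nonneg θ]
    _ = _ := by ring

end Autoregression

/-! ### Whitening on the `d`-dimensional grid -/

section Tensor

open Matrix

variable {d n : ℕ}

/-- The `d`-fold Kronecker power of a matrix. -/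
def tensorPow (d : ℕ) (A : Matrix (Fin n) (Fin n) ℝ) :
    Matrix (Fin d → Fin n) (Fin d → Fin n) ℝ :=
  Matrix.of fun k l => ∏ j, A (k j) (l j)

theorem sum_prod_eq_prod_sum {R : Type*} [CommSemiring R] (f : Fin d → Fin n → R) :
    ∑ l : Fin d → Fin n, ∏ j, f j (l j) = ∏ j, ∑ i, f j i := by
  rw [Finset.prod_univ_sum, Fintype.piFinset_univ]

theorem tensorPow_mul (A B : Matrix (Fin n) (Fin n) ℝ) :
    tensorPow d A * tensorPow d B = tensorPow d (A * B) := by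
  ext k l
  simp only [tensorPow, Matrix.mul_apply, Matrix.of_apply, ← Finset.prod_mul_distrib]
  exact sum_prod_eq_prod_sum fun j i => A (k j) i * B i (l j)

theorem tensorPow_one : tensorPow d (1 : Matrix (Fin n) (Fin n) ℝ) = 1 := by
  ext k l
  simp only [tensorPow, Matrix.of_apply, Matrix.one_apply]
  by_cases h : k = l
  · simp [h]
  · rw [if_neg h]
    obtain ⟨j, hj⟩ := Function.ne_iff.mp h
    exact Finset.prod_eq_zero (Finset.mem_univ j) (if_neg hj)

/-- The one-dimensional factor as a matrix. -/
noncomputable def arMatrix (n : ℕ) (ρ : ℝ) : Matrix (Fin n) (Fin n) ℝ :=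
  Matrix.of fun k l => arFactor ρ k l

theorem arMatrix_mul_transpose {δ : ℝ} (hδ : 0 < δ) :
    arMatrix n (Real.exp (-δ)) * (arMatrix n (Real.exp (-δ)))ᵀ
      = Matrix.of fun k l : Fin n => Real.exp (-|δ * ((k : ℕ) + 1 : ℝ) - δ * ((l : ℕ) + 1 : ℝ)|) := by
  have hρ : Real.exp (-δ) ^ 2 ≤ 1 := by
    rw [← Real.exp_nat_mul]
    exact Real.exp_le_one_iff.mpr (by push_cast; linarith)
  have key : ∀ k l : Fin n, (k : ℕ) ≤ l → ∑ i : Fin n,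
      arFactor (Real.exp (-δ)) k i * arFactor (Real.exp (-δ)) l i
        = Real.exp (-|δ * ((k : ℕ) + 1 : ℝ) - δ * ((l : ℕ) + 1 : ℝ)|) := by
    intro k l h
    rw [Fin.sum_univ_eq_sum_range
      (fun i => arFactor (Real.exp (-δ)) k i * arFactor (Real.exp (-δ)) l i),
      sum_arFactor_mul hρ h l.2, ← Real.exp_nat_mul, Nat.cast_sub h]
    have h' : ((k : ℕ) : ℝ) ≤ (l : ℕ) := by exact_mod_cast h
    rw [abs_of_nonpos (by nlinarith)]
    congr 1
    ring
  ext k l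
  simp only [arMatrix, Matrix.mul_apply, Matrix.transpose_apply, Matrix.of_apply]
  rcases le_total (k : ℕ) l with h | h
  · exact key k l h
  · rw [abs_sub_comm, ← key l k h]
    exact Finset.sum_congr rfl fun i _ => mul_comm _ _

theorem isUnit_det_arMatrix {ρ : ℝ} (hρ : ρ ^ 2 < 1) : IsUnit (arMatrix n ρ).det := by
  rw [Matrix.det_of_isLowerTriangular, isUnit_iff_ne_zero, Finset.prod_ne_zero_iff]
  · intro i _
    simp only [arMatrix, arFactor, Matrix.of_apply, le_refl, if_true, innovation]
    split_ifs
    · simp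
    · simpa using (Real.sqrt_pos.mpr (by linarith)).ne'
  · intro k l h
    simp only [arMatrix, arFactor, Matrix.of_apply]
    exact if_neg (by simpa using h)

theorem gridMatrix_expKernel {δ : ℝ} (hδ : 0 < δ) :
    gridMatrix n δ (expKernel (d := d))
      = tensorPow d (arMatrix n (Real.exp (-δ))) * (tensorPow d (arMatrix n (Real.exp (-δ))))ᵀ := by
  have h : (tensorPow d (arMatrix n (Real.exp (-δ))))ᵀ
      = tensorPow d (arMatrix n (Real.exp (-δ)))ᵀ := rfl
  rw [h, tensorPow_mul, arMatrix_mul_transpose hδ]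
  ext k l
  simp [gridMatrix, tensorPow, expKernel, gridPoint, ← Finset.sum_neg_distrib, Real.exp_sum]

theorem posDef_gridMatrix_expKernel {δ : ℝ} (hδ : 0 < δ) :
    (gridMatrix n δ (expKernel (d := d))).PosDef := by
  have hρ : Real.exp (-δ) ^ 2 < 1 := exp_neg_sq_lt_one hδ
  set A := arMatrix n (Real.exp (-δ)) with hA
  have hu : tensorPow d A * tensorPow d A⁻¹ = 1 := by
    rw [tensorPow_mul, Matrix.mul_nonsing_inv _ (isUnit_det_arMatrix hρ), tensorPow_one]
  have hu' : IsUnit (tensorPow d A) := IsUnit.of_mul_eq_one _ hu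
  rw [gridMatrix_expKernel hδ, ← hA, ← conjTranspose_eq_transpose_of_trivial]
  exact Matrix.PosDef.mul_conjTranspose_self _ (Matrix.vecMul_injective_of_isUnit hu')

/-- The innovations of the sequence `exp(i δ (k + 1) θ)`. -/
noncomputable def expWhiten (δ θ : ℝ) : ℕ → ℂ :=
  whiten (Real.exp (-δ)) fun k => Complex.exp (((δ * (k + 1) * θ : ℝ) : ℂ) * Complex.I)

/-- The exponential factorizes over coordinates, so its innovations are products of the
one-dimensional ones and no inverse matrix has to be computed. -/
theorem exp_inner_gridPoint {δ : ℝ} (hδ : 0 < δ) (θ : Space d) (k : Fin d → Fin n) :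
    Complex.exp (((inner ℝ (gridPoint δ k) θ : ℝ) : ℂ) * Complex.I)
      = ∑ l : Fin d → Fin n, ((tensorPow d (arMatrix n (Real.exp (-δ))) k l : ℝ) : ℂ)
        * ∏ j, expWhiten δ (θ j) (l j) := by
  simp only [tensorPow, Matrix.of_apply, Complex.ofReal_prod, ← Finset.prod_mul_distrib]
  rw [sum_prod_eq_prod_sum fun j i =>
    ((arMatrix n (Real.exp (-δ)) (k j) i : ℝ) : ℂ) * expWhiten δ (θ j) i]
  have h1 : ∀ j, ∑ i, ((arMatrix n (Real.exp (-δ)) (k j) i : ℝ) : ℂ) * expWhiten δ (θ j) i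
      = Complex.exp (((δ * ((k j : ℕ) + 1) * θ j : ℝ) : ℂ) * Complex.I) := by
    intro j
    have h2 := sum_arFactor_whiten (exp_neg_sq_lt_one hδ)
      (fun k => Complex.exp (((δ * (k + 1) * θ j : ℝ) : ℂ) * Complex.I)) (k j).2
    rw [← h2]
    exact Fin.sum_univ_eq_sum_range
      (fun i => (arFactor (Real.exp (-δ)) (k j) i : ℂ) * expWhiten δ (θ j) i) n
  simp_rw [h1]
  rw [← Complex.exp_sum, ← Finset.sum_mul, PiLp.inner_apply, Complex.ofReal_sum]
  congr 2
  refine Finset.sum_congr rfl fun j _ => ?_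
  congr 1
  simp [gridPoint]
  ring

theorem sum_norm_prod_expWhiten_sq_le {δ : ℝ} (hδ : 0 < δ) (hn : 1 ≤ n * δ) (θ : Space d) :
    ∑ l : Fin d → Fin n, ‖∏ j, expWhiten δ (θ j) (l j)‖ ^ 2
      ≤ (16 * (n * δ)) ^ d * Real.exp (‖θ‖ ^ 2 / 8) := by
  simp_rw [norm_prod, ← Finset.prod_pow]
  rw [sum_prod_eq_prod_sum fun j (i : Fin n) => ‖expWhiten δ (θ j) i‖ ^ 2]
  have h1 : (16 * (n * δ)) ^ d * Real.exp (‖θ‖ ^ 2 / 8)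
      = ∏ j : Fin d, 16 * (n * δ) * Real.exp (θ j ^ 2 / 8) := by
    rw [Finset.prod_mul_distrib, ← Real.exp_sum, ← Finset.sum_div, EuclideanSpace.real_norm_sq_eq]
    simp
  rw [h1]
  refine Finset.prod_le_prod (fun j _ => Finset.sum_nonneg fun i _ => by positivity) fun j _ => ?_
  rw [Fin.sum_univ_eq_sum_range (fun i => ‖expWhiten δ (θ j) i‖ ^ 2) n]
  exact sum_norm_whiten_sq_le hδ (θ j) hn

theorem sum_mul_exp_inner_gridPoint {δ : ℝ} (hδ : 0 < δ) (θ : Space d)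
    (a : (Fin d → Fin n) → ℝ) :
    ((∑ k, a k * Real.cos (inner ℝ (gridPoint δ k) θ) : ℝ) : ℂ)
        + ((∑ k, a k * Real.sin (inner ℝ (gridPoint δ k) θ) : ℝ) : ℂ) * Complex.I
      = ∑ l, ((((tensorPow d (arMatrix n (Real.exp (-δ))))ᵀ *ᵥ a) l : ℝ) : ℂ)
        * ∏ j, expWhiten δ (θ j) (l j) := by
  have h1 : ((∑ k, a k * Real.cos (inner ℝ (gridPoint δ k) θ) : ℝ) : ℂ)
      + ((∑ k, a k * Real.sin (inner ℝ (gridPoint δ k) θ) : ℝ) : ℂ) * Complex.I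
      = ∑ k, (a k : ℂ) * Complex.exp (((inner ℝ (gridPoint δ k) θ : ℝ) : ℂ) * Complex.I) := by
    simp only [Complex.ofReal_sum, Complex.ofReal_mul]
    rw [Finset.sum_mul, ← Finset.sum_add_distrib]
    refine Finset.sum_congr rfl fun k _ => ?_
    rw [Complex.exp_mul_I, Complex.ofReal_cos, Complex.ofReal_sin]
    ring
  rw [h1]
  simp_rw [exp_inner_gridPoint hδ, Finset.mul_sum]
  rw [Finset.sum_comm]
  refine Finset.sum_congr rfl fun l _ => ?_
  simp only [Matrix.mulVec, dotProduct, Matrix.transpose_apply, Complex.ofReal_sum,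
    Complex.ofReal_mul]
  rw [Finset.sum_mul]
  exact Finset.sum_congr rfl fun k _ => by ring

theorem dotProduct_gridMatrix_expKernel {δ : ℝ} (hδ : 0 < δ) (a : (Fin d → Fin n) → ℝ) :
    a ⬝ᵥ gridMatrix n δ (expKernel (d := d)) *ᵥ a
      = ∑ l, ((tensorPow d (arMatrix n (Real.exp (-δ))))ᵀ *ᵥ a) l ^ 2 := by
  rw [gridMatrix_expKernel hδ, ← Matrix.mulVec_mulVec, Matrix.dotProduct_mulVec,
    ← Matrix.mulVec_transpose]
  simp only [dotProduct, sq]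

theorem norm_sum_mul_sq_le {κ : Type*} [Fintype κ] (b : κ → ℝ) (m : κ → ℂ) :
    ‖∑ l, ((b l : ℝ) : ℂ) * m l‖ ^ 2 ≤ (∑ l, ‖m l‖ ^ 2) * ∑ l, b l ^ 2 := by
  calc ‖∑ l, ((b l : ℝ) : ℂ) * m l‖ ^ 2 ≤ (∑ l, ‖m l‖ * |b l|) ^ 2 := by
        refine pow_le_pow_left₀ (norm_nonneg _) ?_ 2
        refine (norm_sum_le _ _).trans_eq (Finset.sum_congr rfl fun l _ => ?_)
        rw [norm_mul, Complex.norm_real, Real.norm_eq_abs, mul_comm]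
    _ ≤ (∑ l, ‖m l‖ ^ 2) * ∑ l, |b l| ^ 2 := Finset.sum_mul_sq_le_sq_mul_sq _ _ _
    _ = _ := by simp_rw [sq_abs]

/-- With `A` the Cholesky factor, pairing `a` with the exponential vector equals pairing `Aᵀ a` with
the innovations. Cauchy–Schwarz then applies, since `‖Aᵀ a‖²` is the quadratic form of the grid
matrix. -/
theorem cos_sin_sq_le_expKernel {δ : ℝ} (hδ : 0 < δ) (hn : 1 ≤ n * δ) (θ : Space d)
    (a : (Fin d → Fin n) → ℝ) :
    (∑ k, a k * Real.cos (inner ℝ (gridPoint δ k) θ)) ^ 2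
        + (∑ k, a k * Real.sin (inner ℝ (gridPoint δ k) θ)) ^ 2
      ≤ (16 * (n * δ)) ^ d * Real.exp (‖θ‖ ^ 2 / 8)
        * (a ⬝ᵥ gridMatrix n δ (expKernel (d := d)) *ᵥ a) := by
  rw [dotProduct_gridMatrix_expKernel hδ, ← Complex.normSq_add_mul_I,
    sum_mul_exp_inner_gridPoint hδ, Complex.normSq_eq_norm_sq]
  exact (norm_sum_mul_sq_le _ _).trans (mul_le_mul_of_nonneg_right
    (sum_norm_prod_expWhiten_sq_le hδ hn θ) (Finset.sum_nonneg fun l _ => sq_nonneg _))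

end Tensor

end SpectralMinimax

namespace SpectralMinimax

/-! ### Distinguishability and separation of the two hypotheses -/

section Information

open Matrix

variable {d n : ℕ}

/-- Testing with `a = S⁻¹ v` turns the hypothesis into `q ^ 2 ≤ K * q` for `q = v ⬝ᵥ S⁻¹ *ᵥ v`. Only
upper bounds on pairings are needed, so a lower bound on `S` suffices. -/
theorem dotProduct_inv_mulVec_le {κ : Type*} [Fintype κ] [DecidableEq κ] {S : Matrix κ κ ℝ}
    (hS : S.PosDef) (v : κ → ℝ) {K : ℝ} (hK : 0 ≤ K)
    (hv : ∀ a, (a ⬝ᵥ v) ^ 2 ≤ K * (a ⬝ᵥ S *ᵥ a)) :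
    v ⬝ᵥ S⁻¹ *ᵥ v ≤ K := by
  have h1 := hv (S⁻¹ *ᵥ v)
  have hu : IsUnit S.det := hS.det_pos.ne'.isUnit
  rw [Matrix.mulVec_mulVec, Matrix.mul_nonsing_inv _ hu, Matrix.one_mulVec, dotProduct_comm] at h1
  have h2 : 0 ≤ v ⬝ᵥ S⁻¹ *ᵥ v := by
    have := hS.inv.posSemidef.dotProduct_mulVec_nonneg v
    rwa [star_trivial] at this
  rcases h2.eq_or_lt with h3 | h3
  · exact h3 ▸ hK
  · nlinarith

theorem posSemidef_gridMatrix_cosTransform (δ : ℝ) {w : Space d → ℝ} (hw : Integrable w)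
    (hw0 : ∀ θ, 0 ≤ w θ) : (gridMatrix n δ (cosTransform w)).PosSemidef := by
  refine Matrix.PosSemidef.of_dotProduct_mulVec_nonneg ?_ fun a => ?_
  · refine Matrix.IsHermitian.ext fun k l => ?_
    simp only [gridMatrix, Matrix.of_apply, star_trivial]
    rw [← cosTransform_neg, neg_sub]
  · refine (sum_mul_cosTransform_nonneg hw hw0 Finset.univ a (gridPoint δ)).trans_eq ?_
    simp only [dotProduct, Matrix.mulVec, Pi.star_apply, star_trivial, gridMatrix,
      Matrix.of_apply, Finset.mul_sum]
    exact Finset.sum_congr rfl fun k _ => Finset.sum_congr rfl fun l _ => by ring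

/-- The matrix of `cosTransform w` is the `w`-integral of the rank-one matrices of the cosine and
sine vectors, so the trace is the integral of their quadratic forms under `S⁻¹`. Each form obeys the
whitening bound, whence the factor `2`. -/
theorem trace_inv_mul_gridMatrix_le {δ c : ℝ} (hδ : 0 < δ) (hn : 1 ≤ n * δ) (hc : 0 < c)
    {S : Matrix (Fin d → Fin n) (Fin d → Fin n) ℝ} (hS : S.PosDef)
    (hE : ∀ a, c * (a ⬝ᵥ gridMatrix n δ (expKernel (d := d)) *ᵥ a) ≤ a ⬝ᵥ S *ᵥ a)
    {w : Space d → ℝ} (hw : Integrable w) (hw0 : ∀ θ, 0 ≤ w θ)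
    (hwe : Integrable fun θ : Space d => Real.exp (‖θ‖ ^ 2 / 8) * w θ) :
    (S⁻¹ * gridMatrix n δ (cosTransform w)).trace
      ≤ 2 * (16 * (n * δ)) ^ d / c * ∫ θ, Real.exp (‖θ‖ ^ 2 / 8) * w θ := by
  have h1 : (S⁻¹ * gridMatrix n δ (cosTransform w)).trace
      = ∑ k, ∑ l, S⁻¹ k l * cosTransform w (gridPoint δ k - gridPoint δ l) := by
    simp only [Matrix.trace, Matrix.diag_apply, Matrix.mul_apply, gridMatrix, Matrix.of_apply]
    refine Finset.sum_congr rfl fun k _ => Finset.sum_congr rfl fun l _ => ?_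
    rw [← cosTransform_neg, neg_sub]
  rw [h1, sum_mul_cosTransform hw Finset.univ (fun k l => S⁻¹ k l) (gridPoint δ),
    ← integral_const_mul]
  have h2 : ∀ θ : Space d,
      ∑ k, ∑ l, S⁻¹ k l * Real.cos (inner ℝ (gridPoint δ k - gridPoint δ l) θ)
        = (fun k => Real.cos (inner ℝ (gridPoint δ k) θ)) ⬝ᵥ S⁻¹ *ᵥ
            (fun k => Real.cos (inner ℝ (gridPoint δ k) θ))
          + (fun k => Real.sin (inner ℝ (gridPoint δ k) θ)) ⬝ᵥ S⁻¹ *ᵥ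
            (fun k => Real.sin (inner ℝ (gridPoint δ k) θ)) := by
    intro θ
    simp only [dotProduct, Matrix.mulVec, Finset.mul_sum, ← Finset.sum_add_distrib]
    refine Finset.sum_congr rfl fun k _ => Finset.sum_congr rfl fun l _ => ?_
    rw [inner_sub_left, Real.cos_sub]
    ring
  have h3 : ∀ v : (Fin d → Fin n) → ℝ, 0 ≤ v ⬝ᵥ S⁻¹ *ᵥ v := fun v => by
    have := hS.inv.posSemidef.dotProduct_mulVec_nonneg v
    rwa [star_trivial] at this
  refine integral_mono_of_nonneg (Eventually.of_forall fun θ => ?_) (hwe.const_mul _)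
    (Eventually.of_forall fun θ => ?_)
  · refine mul_nonneg ?_ (hw0 θ)
    rw [h2]
    exact add_nonneg (h3 _) (h3 _)
  · change _ * w θ ≤ 2 * (16 * ((n : ℝ) * δ)) ^ d / c * (Real.exp (‖θ‖ ^ 2 / 8) * w θ)
    rw [h2, ← mul_assoc (2 * (16 * ((n : ℝ) * δ)) ^ d / c)]
    refine mul_le_mul_of_nonneg_right ?_ (hw0 θ)
    have h4 : ∀ a : (Fin d → Fin n) → ℝ, (16 * (n * δ)) ^ d * Real.exp (‖θ‖ ^ 2 / 8)
        * (a ⬝ᵥ gridMatrix n δ (expKernel (d := d)) *ᵥ a)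
        ≤ (16 * (n * δ)) ^ d * Real.exp (‖θ‖ ^ 2 / 8) / c * (a ⬝ᵥ S *ᵥ a) := by
      intro a
      rw [div_mul_eq_mul_div, le_div_iff₀ hc, mul_assoc _ _ c, mul_comm _ c]
      exact mul_le_mul_of_nonneg_left (hE a) (by positivity)
    have h5 := fun a => (cos_sin_sq_le_expKernel hδ hn θ a).trans (h4 a)
    have h6 := dotProduct_inv_mulVec_le hS (fun k => Real.cos (inner ℝ (gridPoint δ k) θ))
      (by positivity) fun a => (le_add_of_nonneg_right (sq_nonneg _)).trans (h5 a)
    have h7 := dotProduct_inv_mulVec_le hS (fun k => Real.sin (inner ℝ (gridPoint δ k) θ))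
      (by positivity) fun a => (le_add_of_nonneg_left (sq_nonneg _)).trans (h5 a)
    refine (add_le_add h6 h7).trans_eq ?_
    ring

/-- The covariance function of the reference process. -/
noncomputable def baseCov (θ₀ : Space d) (β a c : ℝ) (x : Space d) : ℝ :=
  c * expKernel x + a * 1 ^ β * cosTransform (bump θ₀ 1) x

/-- The covariance function of the perturbation. -/
noncomputable def bumpCov (θ₀ : Space d) (β a h : ℝ) (x : Space d) : ℝ :=
  a * h ^ β * cosTransform (bump θ₀ h) x

/-- The data cannot distinguish reliably the reference process from its perturbation. -/
theorem testing_baseCov_bumpCov (θ₀ : Space d) {β a c h δ : ℝ} (ha : 0 < a)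
    (hc : 0 < c) (hh : 0 < h) (h1 : h ≤ 1) (hδ : 0 < δ) (hn : 1 ≤ n * δ)
    {B : Set (EuclideanSpace ℝ (Fin d → Fin n))} (hB : MeasurableSet B) :
    ENNReal.ofReal (Real.exp (-(h ^ β * (a * h ^ β * (2 * (16 * (n * δ)) ^ d / c
        * (Real.exp (‖θ₀‖ ^ 2 / 4) * (4 * Real.pi) ^ ((d : ℝ) / 2) * h ^ d)))) / 8) / 2)
      ≤ multivariateGaussian 0 (gridMatrix n δ (baseCov θ₀ β a c)) B
        + multivariateGaussian 0
          (gridMatrix n δ fun x => baseCov θ₀ β a c x + bumpCov θ₀ β a h x) Bᶜ := by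
  have hw : ∀ {h : ℝ}, ∀ θ, 0 ≤ bump θ₀ h θ := fun θ => (bump_pos _ _ θ).le
  set E := gridMatrix n δ (expKernel (d := d)) with hEdef
  set D₁ := gridMatrix n δ (cosTransform (bump θ₀ 1)) with hD₁
  set D := gridMatrix n δ (cosTransform (bump θ₀ h)) with hD
  have hPD₁ : D₁.PosSemidef :=
    posSemidef_gridMatrix_cosTransform δ (integrable_bump θ₀ one_pos) hw
  have hPD : D.PosSemidef := posSemidef_gridMatrix_cosTransform δ (integrable_bump θ₀ hh) hw
  have hPE : E.PosDef := posDef_gridMatrix_expKernel hδ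
  have eS : gridMatrix n δ (baseCov θ₀ β a c) = c • E + a • D₁ := by
    ext k l
    simp [gridMatrix, baseCov, hEdef, hD₁]
  have eSD : gridMatrix n δ (fun x => baseCov θ₀ β a c x + bumpCov θ₀ β a h x)
      = (c • E + a • D₁) + (a * h ^ β) • D := by
    ext k l
    simp [gridMatrix, baseCov, bumpCov, hEdef, hD₁, hD]
  have hPS : (c • E + a • D₁).PosDef := (hPE.smul hc).add_posSemidef (hPD₁.smul ha.le)
  have hhβ : 0 < h ^ β := Real.rpow_pos_of_pos hh β
  have hsub : (D₁ - D).PosSemidef := by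
    have h2 : D₁ - D = gridMatrix n δ (cosTransform fun θ => bump θ₀ 1 θ - bump θ₀ h θ) := by
      ext k l
      simp only [hD₁, hD, gridMatrix, Matrix.sub_apply, Matrix.of_apply, cosTransform, mul_sub]
      rw [integral_sub (integrable_cos_mul (integrable_bump θ₀ one_pos) _)
        (integrable_cos_mul (integrable_bump θ₀ hh) _)]
    rw [h2]
    exact posSemidef_gridMatrix_cosTransform δ
      ((integrable_bump θ₀ one_pos).sub (integrable_bump θ₀ hh))
      fun θ => sub_nonneg.mpr (bump_mono θ₀ hh h1 θ)
  -- The relative eigenvalues are at most `h ^ β` since `a • D ≤ a • D₁ ≤ S`. This is the first of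
  -- two powers `h ^ β`; the other is the amplitude in the trace.
  have hk : (h ^ β • (c • E + a • D₁) - (a * h ^ β) • D).PosSemidef := by
    have h2 : h ^ β • (c • E + a • D₁) - (a * h ^ β) • D
        = (h ^ β * c) • E + (a * h ^ β) • (D₁ - D) := by
      rw [smul_add, smul_smul, smul_smul, smul_sub, mul_comm (h ^ β) a, add_sub_assoc]
    rw [h2]
    exact (hPE.posSemidef.smul (by positivity)).add (hsub.smul (by positivity))
  have hE : ∀ b, c * (b ⬝ᵥ E *ᵥ b) ≤ b ⬝ᵥ (c • E + a • D₁) *ᵥ b := by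
    intro b
    have h2 := (hPD₁.smul ha.le).dotProduct_mulVec_nonneg b
    rw [star_trivial] at h2
    rw [Matrix.add_mulVec, dotProduct_add, Matrix.smul_mulVec, dotProduct_smul, smul_eq_mul]
    exact le_add_of_nonneg_right h2
  obtain ⟨hi, hle⟩ := integral_exp_mul_bump_le θ₀ hh h1
  have htr := trace_inv_mul_gridMatrix_le hδ hn hc hPS hE (integrable_bump θ₀ hh) hw hi
  have hτ : ((c • E + a • D₁)⁻¹ * ((a * h ^ β) • D)).trace
      ≤ a * h ^ β * (2 * (16 * (n * δ)) ^ d / c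
        * (Real.exp (‖θ₀‖ ^ 2 / 4) * (4 * Real.pi) ^ ((d : ℝ) / 2) * h ^ d)) := by
    rw [mul_smul_comm, Matrix.trace_smul, smul_eq_mul]
    refine mul_le_mul_of_nonneg_left (htr.trans ?_) (by positivity)
    exact mul_le_mul_of_nonneg_left hle (by positivity)
  rw [eS, eSD]
  exact multivariateGaussian_testing _ _ hPS (hPD.smul (by positivity)) hhβ.le hk hτ hB

theorem separation_baseCov_bumpCov (θ₀ : Space d) {β L a c h : ℝ}
    (ha : 0 < a) (hh : 0 < h) (h₀ : IsAdmissible β L (baseCov θ₀ β a c)) :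
    a * h ^ β / 2 ≤ ‖scalarTransform (fun x => baseCov θ₀ β a c x + bumpCov θ₀ β a h x) θ₀
      - scalarTransform (baseCov θ₀ β a c) θ₀‖ := by
  have hb := integrable_cosTransform_bump θ₀ hh
  have hb' : Integrable (bumpCov θ₀ β a h) := hb.const_mul _
  refine le_trans ?_ (Complex.re_le_norm _)
  have hadd : Integrable fun x => baseCov θ₀ β a c x + bumpCov θ₀ β a h x :=
    h₀.integrable.add hb'
  rw [Complex.sub_re, scalarTransform_re hadd, scalarTransform_re h₀.integrable,
    ← mul_sub]
  have hbd : ∀ {g : Space d → ℝ}, Integrable g →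
      Integrable fun x => Real.cos (inner ℝ x θ₀) * g x := fun hg =>
    hg.bdd_mul (c := 1) (Measurable.aestronglyMeasurable (by fun_prop))
      (Eventually.of_forall fun θ => Real.abs_cos_le_one _)
  simp_rw [mul_add]
  rw [integral_add (hbd h₀.integrable) (hbd hb'), add_sub_cancel_left]
  have h2 := half_le_scalarTransform_cosTransform_bump θ₀ hh
  rw [scalarTransform_re hb] at h2
  have h3 : ∀ x, Real.cos (inner ℝ x θ₀) * bumpCov θ₀ β a h x
      = a * h ^ β * (Real.cos (inner ℝ x θ₀) * cosTransform (bump θ₀ h) x) := fun x => by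
    simp only [bumpCov]; ring
  simp_rw [h3]
  rw [integral_const_mul]
  have hhβ : 0 < h ^ β := Real.rpow_pos_of_pos hh β
  calc a * h ^ β / 2 = a * h ^ β * (1 / 2) := by ring
    _ ≤ a * h ^ β * _ := mul_le_mul_of_nonneg_left h2 (by positivity)
    _ = _ := by ring

theorem exists_admissible_constants {β L : ℝ} (hβ : 0 < β) (hL : 0 < L) (θ₀ : Space d) :
    ∃ a c : ℝ, 0 < a ∧ 0 < c ∧ IsAdmissible β L (baseCov θ₀ β a c) ∧
      ∀ h, 0 < h → h ≤ 1 →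
        IsAdmissible β L fun x => baseCov θ₀ β a c x + bumpCov θ₀ β a h x := by
  set I₁ := (2 * Real.pi) ^ ((d : ℝ) / 2)
    * ∫ x : Space d, (1 + ‖x‖ ^ β) * Real.exp (-‖x‖ ^ 2 / 2) with hI₁
  set I₂ := ∫ x : Space d, (1 + ‖x‖ ^ β) * Real.exp (-‖x‖) with hI₂
  have h1 : 0 ≤ I₁ := mul_nonneg (by positivity) (integral_nonneg fun x => by positivity)
  have h2 : 0 ≤ I₂ := integral_nonneg fun x => by positivity
  -- The budget `L` is split equally among the exponential kernel, the wide bump and the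
  -- perturbation; `I + 1` keeps the denominators positive.
  have key : ∀ I : ℝ, 0 ≤ I → L / (3 * (I + 1)) * I ≤ L / 3 := by
    intro I hI
    rw [div_mul_eq_mul_div, div_le_div_iff₀ (by positivity) (by norm_num)]
    nlinarith
  have hb : ∀ h, 0 < h → h ≤ 1 → IsAdmissible β (L / 3) (bumpCov θ₀ β (L / (3 * (I₁ + 1))) h) :=
    fun h hh hh1 => (isAdmissible_bump hβ θ₀ (by positivity) hh hh1).mono (key I₁ h1)
  have he : IsAdmissible β (L / 3) fun x : Space d => L / (3 * (I₂ + 1)) * expKernel x :=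
    (isAdmissible_expKernel hβ (by positivity)).mono (key I₂ h2)
  -- The factor `1 ^ β` in `baseCov` makes its second term exactly a bump covariance with `h = 1`.
  have h0 : IsAdmissible β (L / 3 + L / 3)
      (baseCov θ₀ β (L / (3 * (I₁ + 1))) (L / (3 * (I₂ + 1)))) :=
    he.add (hb 1 one_pos le_rfl) (by positivity) (by positivity)
  refine ⟨L / (3 * (I₁ + 1)), L / (3 * (I₂ + 1)), by positivity, by positivity,
    h0.mono (by linarith), fun h hh hh1 => ?_⟩
  exact (h0.add (hb h hh hh1) (by positivity) (by positivity)).mono (by linarith)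

end Information

end SpectralMinimax

/-! ### Choice of the bandwidth and conclusion -/

theorem mainTheorem3 {ι H : Type*} [NormedAddCommGroup H] [InnerProductSpace ℂ H] [CompleteSpace H]
    [TopologicalSpace.SeparableSpace H] [Nontrivial H] [MeasurableSpace H] [BorelSpace H]
    (e : HilbertBasis ι ℂ H) (d : ℕ) (hd : 0 < d) (β L : ℝ) (hβ : 0 < β) (hL : 0 < L)
    (δ : ℕ → ℝ) (hδ : ∀ n, 0 < δ n) (hnδ : Tendsto (fun n : ℕ => (n : ℝ) * δ n) atTop atTop)
    (θ₀ : SpectralMinimax.Space d) :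
    0 < liminf (fun n : ℕ =>
      ⨅ T ∈ SpectralMinimax.estimators H d n,
        ⨆ f ∈ SpectralMinimax.powerLawClass e d β L,
          ⨆ (P : Measure (SpectralMinimax.Space d → H))
            (_ : SpectralMinimax.IsStationaryGaussianLaw e P f),
            P {ω | ENNReal.ofReal (((n : ℝ) * δ n) ^ (-((d : ℝ) * β) / (2 * β + (d : ℝ)))) ≤
              SpectralMinimax.hsNorm e
                (T (SpectralMinimax.observations n (δ n) ω) θ₀ - f θ₀)}) atTop := by
  open SpectralMinimax in
  have hι : Nonempty ι := by
    by_contra hι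
    rw [not_nonempty_iff] at hι
    obtain ⟨x, hx⟩ := exists_ne (0 : H)
    refine hx (e.repr.injective ?_)
    ext i
    exact hι.elim i
  obtain ⟨j⟩ := hι
  obtain ⟨a, c, ha, hc, h₀, h₁⟩ := exists_admissible_constants hβ hL θ₀
  have hdR : (0 : ℝ) < d := by exact_mod_cast hd
  have hs : 0 < 2 * β + (d : ℝ) := by positivity
  set p : ℝ := (d : ℝ) / (2 * β + d) with hp
  have hp0 : 0 < p := by positivity
  -- With this constant in `h = b * t ^ (-p)`, the separation `a * h ^ β / 2` is exactly twice the
  -- rate.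
  set b : ℝ := (4 / a) ^ (1 / β) with hb
  have hb0 : 0 < b := Real.rpow_pos_of_pos (by positivity) _
  set C : ℝ := Real.exp (‖θ₀‖ ^ 2 / 4) * (4 * Real.pi) ^ ((d : ℝ) / 2) with hC
  set M : ℝ := b ^ (2 * β + (d : ℝ)) * (a * (2 * 16 ^ d / c * C)) with hM
  have hpos : (0 : ℝ≥0∞) < ENNReal.ofReal (Real.exp (-M / 8) / 2) / 2 :=
    ENNReal.div_pos (ENNReal.ofReal_pos.mpr (by positivity)).ne' (by simp)
  have hlim : Tendsto (fun n : ℕ => b * ((n : ℝ) * δ n) ^ (-p)) atTop (𝓝 0) := by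
    have := ((tendsto_rpow_neg_atTop hp0).comp hnδ).const_mul b
    simpa using this
  refine lt_of_lt_of_le hpos (le_liminf_of_le (by isBoundedDefault) ?_)
  filter_upwards [hnδ.eventually_ge_atTop 1, hlim.eventually_le_const one_pos] with n hn hh1
  set t : ℝ := (n : ℝ) * δ n with ht
  have ht0 : 0 < t := by linarith
  set h : ℝ := b * t ^ (-p) with hh
  have hh0 : 0 < h := mul_pos hb0 (Real.rpow_pos_of_pos ht0 _)
  have ehβ : h ^ β = 4 / a * t ^ (-((d : ℝ) * β) / (2 * β + (d : ℝ))) := by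
    rw [hh, Real.mul_rpow hb0.le (Real.rpow_nonneg ht0.le _), ← Real.rpow_mul ht0.le, hb,
      ← Real.rpow_mul (by positivity), one_div_mul_cancel hβ.ne', Real.rpow_one]
    congr 2
    rw [hp]
    field_simp
  -- Since `h ^ (2 * β + d)` is a constant times `t ^ (-d)`, the powers of `t` cancel and the
  -- testing bound does not depend on `n`.
  have ehM : h ^ β * (a * h ^ β * (2 * (16 * t) ^ d / c * (C * h ^ d))) = M := by
    have h2 : h ^ β * h ^ β * h ^ d = b ^ (2 * β + (d : ℝ)) * (t ^ d)⁻¹ := by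
      rw [← Real.rpow_natCast h d, ← Real.rpow_add hh0, ← Real.rpow_add hh0, ← two_mul, hh,
        Real.mul_rpow hb0.le (Real.rpow_nonneg ht0.le _), ← Real.rpow_mul ht0.le,
        ← Real.rpow_natCast t d, ← Real.rpow_neg ht0.le]
      congr 2
      rw [hp]
      field_simp
    calc h ^ β * (a * h ^ β * (2 * (16 * t) ^ d / c * (C * h ^ d)))
        = (h ^ β * h ^ β * h ^ d) * t ^ d * (a * (2 * 16 ^ d / c * C)) := by
          rw [mul_pow]; ring
      _ = M := by rw [h2, hM, inv_mul_cancel_right₀ (by positivity)]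
  refine two_point_lower_bound h₀ (h₁ h hh0 hh1) e j ?_ fun B hB => ?_
  · refine le_trans (le_of_eq ?_) (separation_baseCov_bumpCov θ₀ ha hh0 h₀)
    rw [ehβ]
    field_simp
    ring
  · have h2 := testing_baseCov_bumpCov (β := β) θ₀ ha hc hh0 hh1 (hδ n) hn hB
    rwa [← ht, ← hC, ehM] at h2
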